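/- **Theorem 4.2 (Maximum Principle).** Let $n\ge 2$, $k\in\{1,\dots,n-1\}$ and $L\ge 1$. For $p\in\mathbb{R}^n$ and a symmetric matrix $M\in\mathbb{S}^n$ put $$F(p,M):=\inf\Big\{-\tfrac12\operatorname{tr}(Ma):\ a\in\mathbb{S}^n,\ a\succeq 0,\ ap=0,\ \lambda_{(n-k)}(a)\ge 1,\ \lambda_{(1)}(a)\le L\Big\},$$ where $\lambda_{(1)}(a)\ge\dots\ge\lambda_{(n)}(a)$ are the eigenvalues of $a$. Let $F_*$, $F^*$ be the lower and upper semicontinuous envelopes of $F$ on $\mathbb{R}^n\times\mathbb{S}^n$; for a bounded function $u$ on a compact set $K\subset\mathbb{R}^n$ let $u_*$, $u^*$ be its semicontinuous envelopes on $K$. A bounded $u:K\to\mathbb{R}$ is a *viscosity subsolution* of $F(\nabla u,\nabla^2u)=1$ on $K$ if for every interior point $x$ of $K$ and every $\varphi\in C^2(\mathbb{R}^n)$ with $(u^*-\varphi)(x)=\max_K(u^*-\varphi)$ one has $F_*(\nabla\varphi(x),\nabla^2\varphi(x))\le 1$; as a subsolution it satisfies the *zero boundary condition* if the same holds at every $x\in\partial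 K$ with $u^*(x)>0$. A bounded $w:K\to\mathbb{R}$ is a *viscosity supersolution* on $K$ if for every interior point $x$ of $K$ and every $\varphi\in C^2(\mathbb{R}^n)$ with $(w_*-\varphi)(x)=\min_K(w_*-\varphi)$ one has $F^*(\nabla\varphi(x),\nabla^2\varphi(x))\ge 1$; as a supersolution it satisfies the *zero boundary condition* if the same holds at every $x\in\partial K$ with $w_*(x)<0$. Let $K\subset\mathbb{R}^n$ be compact and let $u:K\to\mathbb{R}$ be an upper semicontinuous viscosity subsolution of $F(\nabla u,\nabla^2u)=1$ on $K$. (a) If $K\neq\emptyset$ and $w:K\to\mathbb{R}$ is a lower semicontinuous viscosity supersolution of $F(\nabla w,\nabla^2w)=1$ on $K$, then there is a point $x\in\partial K$ at which $u-w$ attains its maximum over $K$. (b) If $u$ satisfies the zero boundary condition, $K'\subset\mathbb{R}^n$ is compact with $K\subset\operatorname{int}K'$, and $w:K'\to\mathbb{R}$ is a lower semicontinuous viscosity supersolution of $F(\nabla w,\nabla^2w)=1$ on $K'$ satisfying the zero boundary condition, then $u\le w$ on $K$. -/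

import Mathlib

open Filter Topology Matrix

noncomputable section

namespace CodimFlow

/-- The upper semicontinuous envelope of `f : S → ℝ` at `x`, that is
`lim_{ε ↓ 0} sup {f y | y ∈ S, |y - x| < ε}`. Only the values of `f` on `S` matter. -/
def uscEnv {X : Type*} [TopologicalSpace X] (S : Set X) (f : X → ℝ) (x : X) : ℝ :=
  limsup f (𝓝[S] x)

/-- The lower semicontinuous envelope of `f : S → ℝ` at `x`, that is
`lim_{ε ↓ 0} inf {f y | y ∈ S, |y - x| < ε}`. Only the values of `f` on `S` matter. -/
def lscEnv {X : Type*} [TopologicalSpace X] (S : Set X) (f : X → ℝ) (x : X) : ℝ :=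
  liminf f (𝓝[S] x)

variable {n : ℕ}

/-- `orderedEigenvalue a i` is the `i`-th largest eigenvalue of the symmetric matrix `a`, counted
with multiplicity, for `1 ≤ i ≤ n` (and `0` outside of this range). -/
def orderedEigenvalue (a : Matrix (Fin n) (Fin n) ℝ) (i : ℕ) : ℝ :=
  open Classical in
  if h : a.IsHermitian ∧ 1 ≤ i ∧ i ≤ n then
    h.1.eigenvalues₀ ⟨i - 1, by rw [Fintype.card_fin]; omega⟩
  else 0

/-- The matrices admissible in the definition of the nonlinearity at `p`:
`a ⪰ 0`, `a p = 0`, `λ_{(n-k)}(a) ≥ 1` and `λ_{(1)}(a) ≤ L`. -/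
def admissible (k : ℕ) (L : ℝ) (p : EuclideanSpace ℝ (Fin n)) :
    Set (Matrix (Fin n) (Fin n) ℝ) :=
  {a | a.PosSemidef ∧ a *ᵥ p.ofLp = 0 ∧
    1 ≤ orderedEigenvalue a (n - k) ∧ orderedEigenvalue a 1 ≤ L}

/-- The nonlinearity `F(p, M) = inf {-tr(M a) / 2 | a admissible at p}`. -/
def nonlin (k : ℕ) (L : ℝ) (q : EuclideanSpace ℝ (Fin n) × Matrix (Fin n) (Fin n) ℝ) : ℝ :=
  sInf ((fun a => -(1 / 2 : ℝ) * (q.2 * a).trace) '' admissible k L q.1)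

/-- The domain `ℝⁿ × 𝕊ⁿ` of `F`, with `𝕊ⁿ` the symmetric matrices. -/
def symDomain (n : ℕ) : Set (EuclideanSpace ℝ (Fin n) × Matrix (Fin n) (Fin n) ℝ) :=
  {q | q.2.IsSymm}

/-- `F_*`, the lower semicontinuous envelope of `F` on `ℝⁿ × 𝕊ⁿ`. -/
def nonlinLower (k : ℕ) (L : ℝ) (p : EuclideanSpace ℝ (Fin n)) (M : Matrix (Fin n) (Fin n) ℝ) : ℝ :=
  lscEnv (symDomain n) (nonlin k L) (p, M)

/-- `F^*`, the upper semicontinuous envelope of `F` on `ℝⁿ × 𝕊ⁿ`. -/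
def nonlinUpper (k : ℕ) (L : ℝ) (p : EuclideanSpace ℝ (Fin n)) (M : Matrix (Fin n) (Fin n) ℝ) : ℝ :=
  uscEnv (symDomain n) (nonlin k L) (p, M)

/-- The Hessian matrix `∇²φ(x)`. -/
def hessian (φ : EuclideanSpace ℝ (Fin n) → ℝ) (x : EuclideanSpace ℝ (Fin n)) :
    Matrix (Fin n) (Fin n) ℝ :=
  Matrix.of fun i j =>
    fderiv ℝ (fderiv ℝ φ) x (EuclideanSpace.single i 1) (EuclideanSpace.single j 1)

/-- The subsolution inequality at `x`: `F_*(∇φ(x), ∇²φ(x)) ≤ 1` for every `φ ∈ C²(ℝⁿ)` such that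
`u^* - φ` has its maximum over `K` at `x`. -/
def SubsolutionAt (k : ℕ) (L : ℝ) (K : Set (EuclideanSpace ℝ (Fin n)))
    (u : EuclideanSpace ℝ (Fin n) → ℝ) (x : EuclideanSpace ℝ (Fin n)) : Prop :=
  ∀ φ : EuclideanSpace ℝ (Fin n) → ℝ, ContDiff ℝ 2 φ →
    IsMaxOn (fun y => uscEnv K u y - φ y) K x → nonlinLower k L (gradient φ x) (hessian φ x) ≤ 1

/-- The supersolution inequality at `x`: `F^*(∇φ(x), ∇²φ(x)) ≥ 1` for every `φ ∈ C²(ℝⁿ)` such that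
`u_* - φ` has its minimum over `K` at `x`. -/
def SupersolutionAt (k : ℕ) (L : ℝ) (K : Set (EuclideanSpace ℝ (Fin n)))
    (u : EuclideanSpace ℝ (Fin n) → ℝ) (x : EuclideanSpace ℝ (Fin n)) : Prop :=
  ∀ φ : EuclideanSpace ℝ (Fin n) → ℝ, ContDiff ℝ 2 φ →
    IsMinOn (fun y => lscEnv K u y - φ y) K x → 1 ≤ nonlinUpper k L (gradient φ x) (hessian φ x)

/-- `u : K → ℝ` is a (bounded) viscosity subsolution of `F(∇u, ∇²u) = 1` in the interior of `K`. -/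
def IsViscositySubsolution (k : ℕ) (L : ℝ) (K : Set (EuclideanSpace ℝ (Fin n)))
    (u : EuclideanSpace ℝ (Fin n) → ℝ) : Prop :=
  (∃ C : ℝ, ∀ x ∈ K, |u x| ≤ C) ∧ ∀ x ∈ interior K, SubsolutionAt k L K u x

/-- `u : K → ℝ` is a (bounded) viscosity supersolution of `F(∇u, ∇²u) = 1` in the interior of
`K`. -/
def IsViscositySupersolution (k : ℕ) (L : ℝ) (K : Set (EuclideanSpace ℝ (Fin n)))
    (u : EuclideanSpace ℝ (Fin n) → ℝ) : Prop :=
  (∃ C : ℝ, ∀ x ∈ K, |u x| ≤ C) ∧ ∀ x ∈ interior K, SupersolutionAt k L K u x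

/-- The zero boundary condition for subsolutions, in the viscosity sense. -/
def SubZeroBoundary (k : ℕ) (L : ℝ) (K : Set (EuclideanSpace ℝ (Fin n)))
    (u : EuclideanSpace ℝ (Fin n) → ℝ) : Prop :=
  ∀ x ∈ frontier K, 0 < uscEnv K u x → SubsolutionAt k L K u x

/-- The zero boundary condition for supersolutions, in the viscosity sense. -/
def SuperZeroBoundary (k : ℕ) (L : ℝ) (K : Set (EuclideanSpace ℝ (Fin n)))
    (u : EuclideanSpace ℝ (Fin n) → ℝ) : Prop :=
  ∀ x ∈ frontier K, lscEnv K u x < 0 → SupersolutionAt k L K u x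

end CodimFlow

end

open CodimFlow

noncomputable section

namespace CodimFlow

open MeasureTheory RealInnerProductSpace

/-! `F` is positively 1-homogeneous, so for `0 < s < 1` the function `s * u` satisfies `F ≤ s`,
strictly below the value 1 for `w`. Both parts reduce to `false_of_forall_near_max`: the two
viscosity inequalities cannot hold at all pairs of close points where `s * u x - w y` is nearly as
large as at a given point.

For this, `s * u` and `-w` are replaced by sup-convolutions `S₁`, `S₂`, and `S₁ ξ + S₂ η - m * ‖ξ -
η‖ ^ 4` is maximised. Since `F` does not depend on position, one large `m` suffices. If the maximum
has `ξ = η`, then `w` is touched from below by a function with zero gradient and Hessian, which is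
impossible because `F^*(0, 0) ≤ 0 < 1`; this is where the quartic penalty handles the singularity of
`F` at `p = 0`. If `z = ξ - η ≠ 0`, the difference is frozen at `z` and only `η` varies: the lemmas
of Alexandrov and Jensen give nearby points where `S₁` and `S₂` have second order expansions,
gradients close to `p` and `-p` with `p ≠ 0`, and Hessians with `T₁ + T₂` at most a small multiple
of the identity. Away from `p = 0`, `F` is continuous and degenerate elliptic
(`exists_nonlin_le_add`), because rotating `p` to `q` conjugates the admissible matrices; so `1 ≤ s`
up to small errors, a contradiction.

In (a), a larger interior maximum of `u - w` keeps near-maximal pairs away from the boundary. In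
(b), `w ≥ 0`, so near-maximal pairs have `u > 0` and the boundary condition of `u` applies, while
points of `K'` close to `K` are interior to `K'`. -/

/-! ### Second order expansions of convex functions -/

section Convex

variable {E : Type*} [NormedAddCommGroup E] [InnerProductSpace ℝ E]

/-- `v` is a subgradient of `H` at `ξ`. -/
def IsSubgradient (H : E → ℝ) (ξ v : E) : Prop :=
  ∀ ζ, H ξ + ⟪v, ζ - ξ⟫ ≤ H ζ

/-- `S` has a second order Taylor expansion at `ξ` with gradient `q` and quadratic form
`h ↦ ⟪T h, h⟫`. -/
def HasQuadExpansion (S : E → ℝ) (ξ q : E) (T : E →L[ℝ] E) : Prop :=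
  ∀ τ > 0, ∀ᶠ h in 𝓝 (0 : E),
    |S (ξ + h) - S ξ - ⟪q, h⟫ - 1 / 2 * ⟪T h, h⟫| ≤ τ * ‖h‖ ^ 2

/-- Monotonicity of the subdifferential, from adding the two subgradient inequalities. -/
theorem IsSubgradient.inner_nonneg {H : E → ℝ} {ξ ζ v w : E} (hv : IsSubgradient H ξ v)
    (hw : IsSubgradient H ζ w) : 0 ≤ ⟪v - w, ξ - ζ⟫ := by
  have h1 := hv ζ
  have h2 := hw ξ
  rw [← neg_sub ξ ζ, inner_neg_right] at h1
  rw [inner_sub_left]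
  linarith

theorem lipschitz_of_bounded_subgradients {H : E → ℝ} {R : ℝ}
    (hH : ∀ ξ, ∃ v, ‖v‖ ≤ R ∧ IsSubgradient H ξ v) : LipschitzWith R.toNNReal H := by
  have key : ∀ ξ ζ, H ξ - H ζ ≤ R * ‖ξ - ζ‖ := by
    intro ξ ζ
    obtain ⟨v, hv, hs⟩ := hH ξ
    have h1 := hs ζ
    rw [← neg_sub ξ ζ, inner_neg_right] at h1
    have h2 := real_inner_le_norm v (ξ - ζ)
    nlinarith [norm_nonneg (ξ - ζ)]
  have hR : 0 ≤ R := by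
    obtain ⟨v, hv, -⟩ := hH 0
    exact (norm_nonneg v).trans hv
  refine LipschitzWith.of_dist_le_mul fun ξ ζ => ?_
  rw [Real.coe_toNNReal _ hR, Real.dist_eq, dist_eq_norm, abs_le]
  have := key ξ ζ
  have h2 := key ζ ξ
  rw [norm_sub_rev] at h2
  constructor <;> linarith

theorem convex_ineq_of_subgradients {H : E → ℝ} (hH : ∀ ξ, ∃ v, IsSubgradient H ξ v) (ξ d : E)
    {t : ℝ} (ht0 : 0 ≤ t) (ht1 : t ≤ 1) :
    H (ξ + t • d) ≤ (1 - t) * H ξ + t * H (ξ + d) := by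
  obtain ⟨v, hv⟩ := hH (ξ + t • d)
  have h1 := hv ξ
  have h2 := hv (ξ + d)
  rw [show ξ - (ξ + t • d) = (-t) • d by module, inner_smul_right] at h1
  rw [show ξ + d - (ξ + t • d) = (1 - t) • d by module, inner_smul_right] at h2
  nlinarith

/-- A minimizer of `ζ ↦ H ζ + ‖ζ - z‖² / 2` satisfies its optimality condition. -/
theorem isSubgradient_of_isMin {H : E → ℝ} (hH : ∀ ξ, ∃ v, IsSubgradient H ξ v) {z ξ : E}
    (hmin : ∀ ζ, H ξ + 1 / 2 * ‖ξ - z‖ ^ 2 ≤ H ζ + 1 / 2 * ‖ζ - z‖ ^ 2) :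
    IsSubgradient H ξ (z - ξ) := by
  intro ζ
  set d := ζ - ξ with hd
  -- Moving from `ξ` towards `ζ` by a fraction `t` gives the inequality up to an error linear in
  -- `t`; a small `t` then contradicts strict failure.
  have key : ∀ t : ℝ, 0 < t → t ≤ 1 → 0 ≤ H ζ - H ξ - ⟪z - ξ, d⟫ + t * (1 / 2 * ‖d‖ ^ 2) := by
    intro t ht ht1
    have h1 := hmin (ξ + t • d)
    have h2 := convex_ineq_of_subgradients hH ξ d ht.le ht1
    rw [show ξ + d = ζ by rw [hd]; abel] at h2
    have h3 : ‖ξ + t • d - z‖ ^ 2 = ‖ξ - z‖ ^ 2 - 2 * t * ⟪z - ξ, d⟫ + t ^ 2 * ‖d‖ ^ 2 := by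
      rw [show ξ + t • d - z = (ξ - z) + t • d by abel, norm_add_sq_real, inner_smul_right,
        norm_smul, mul_pow, Real.norm_eq_abs, sq_abs, ← neg_sub z ξ, inner_neg_left, norm_neg]
      ring
    rw [h3] at h1
    have h4 : 0 ≤ t * (H ζ - H ξ - ⟪z - ξ, d⟫ + t * (1 / 2 * ‖d‖ ^ 2)) := by nlinarith
    exact nonneg_of_mul_nonneg_right h4 ht
  by_contra! hlt
  set a := H ξ + ⟪z - ξ, d⟫ - H ζ with ha
  have hapos : 0 < a := by linarith
  set b := 1 / 2 * ‖d‖ ^ 2 with hb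
  have hb0 : 0 ≤ b := by positivity
  have h1 := key (min 1 (a / (2 * (b + 1)))) (by positivity) (min_le_left _ _)
  have h2 : min 1 (a / (2 * (b + 1))) * b ≤ a / (2 * (b + 1)) * (b + 1) :=
    mul_le_mul (min_le_right _ _) (by linarith) hb0 (by positivity)
  have h3 : a / (2 * (b + 1)) * (b + 1) = a / 2 := by field_simp
  linarith

/-- `H` decreases at most linearly with slope `R`, so the quadratic term confines the competitors to
the ball of radius `2 * R` about `z`. The resolvent of the subdifferential is thus defined
everywhere. -/
theorem exists_prox [FiniteDimensional ℝ E] {H : E → ℝ} {R : ℝ}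
    (hH : ∀ ξ, ∃ v, ‖v‖ ≤ R ∧ IsSubgradient H ξ v) (z : E) :
    ∃ ξ, IsSubgradient H ξ (z - ξ) := by
  have hcont : Continuous fun ξ => H ξ + 1 / 2 * ‖ξ - z‖ ^ 2 := by
    have := (lipschitz_of_bounded_subgradients hH).continuous
    fun_prop
  have : ProperSpace E := FiniteDimensional.proper ℝ E
  obtain ⟨ξ, hξ⟩ := hcont.exists_forall_le_of_isBounded z (by
    refine (Metric.isBounded_closedBall (x := z) (r := 2 * R)).subset fun ξ hξ => ?_
    obtain ⟨v, hv, hs⟩ := hH z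
    have h1 := hs ξ
    have h2 := neg_le_of_abs_le (abs_real_inner_le_norm v (ξ - z))
    have h3 : H ξ + 1 / 2 * ‖ξ - z‖ ^ 2 ≤ H z + 1 / 2 * ‖z - z‖ ^ 2 := hξ
    rw [sub_self, norm_zero] at h3
    rw [Metric.mem_closedBall, dist_eq_norm]
    by_contra! hlt
    have h4 : 0 ≤ R := (norm_nonneg v).trans hv
    nlinarith [norm_nonneg (ξ - z), norm_nonneg v])
  exact ⟨ξ, isSubgradient_of_isMin (fun ξ => (hH ξ).imp fun _ h => h.2) hξ⟩

/-- Differentiability of the gradient at the single point `z` is enough: subtract the quadratic part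
along the segment from `z` to `z + k` and apply the mean value inequality. -/
theorem hasQuadExpansion_of_hasFDerivAt_gradient [CompleteSpace E] {e : E → ℝ} {G : E → E} {z : E}
    {B : E →L[ℝ] E} (hG : ∀ y, HasGradientAt e (G y) y) (hB : HasFDerivAt G B z) :
    HasQuadExpansion e z (G z) B := by
  intro τ hτ
  have h1 := (hasFDerivAt_iff_isLittleO_nhds_zero.1 hB).def hτ
  obtain ⟨r, hr, hball⟩ := Metric.eventually_nhds_iff.1 h1
  refine Metric.eventually_nhds_iff.2 ⟨r, hr, fun {k} hk => ?_⟩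
  rw [dist_zero_right] at hk
  set f : ℝ → ℝ := fun t => e (z + t • k) - t * ⟪G z, k⟫ - 1 / 2 * t ^ 2 * ⟪B k, k⟫ with hf
  have hder : ∀ t, HasDerivAt f (⟪G (z + t • k) - G z - t • B k, k⟫) t := by
    intro t
    have a1 : HasDerivAt (fun t : ℝ => z + t • k) k t := by
      simpa using ((hasDerivAt_id t).smul_const k).const_add z
    have a2 : HasDerivAt (fun t : ℝ => e (z + t • k)) ⟪G (z + t • k), k⟫ t := by
      have := (hG (z + t • k)).hasFDerivAt.comp_hasDerivAt t a1
      rwa [InnerProductSpace.toDual_apply_apply] at this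
    have a3 : HasDerivAt (fun t : ℝ => t * ⟪G z, k⟫) ⟪G z, k⟫ t := by
      simpa using (hasDerivAt_id t).mul_const ⟪G z, k⟫
    have a4 : HasDerivAt (fun t : ℝ => 1 / 2 * t ^ 2 * ⟪B k, k⟫) (t * ⟪B k, k⟫) t := by
      have := ((hasDerivAt_pow 2 t).const_mul (1 / 2 : ℝ)).mul_const ⟪B k, k⟫
      exact this.congr_deriv (by push_cast; ring)
    have a5 := (a2.fun_sub a3).fun_sub a4
    rwa [← inner_sub_left, ← real_inner_smul_left, ← inner_sub_left] at a5
  have hmv := norm_image_sub_le_of_norm_deriv_le_segment_01' (f := f) (C := τ * ‖k‖ ^ 2)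
    (fun t _ => (hder t).hasDerivWithinAt) (fun t ht => by
      have b1 := @hball (t • k) (by
        rw [dist_zero_right, norm_smul, Real.norm_of_nonneg ht.1]
        nlinarith [norm_nonneg k, ht.1, ht.2])
      rw [map_smul, norm_smul, Real.norm_of_nonneg ht.1] at b1
      have b2 := abs_real_inner_le_norm (G (z + t • k) - G z - t • B k) k
      rw [Real.norm_eq_abs]
      have b3 : τ * (t * ‖k‖) ≤ τ * ‖k‖ := by
        apply mul_le_mul_of_nonneg_left _ hτ.le
        nlinarith [norm_nonneg k, ht.1, ht.2]
      nlinarith [norm_nonneg k, norm_nonneg (G (z + t • k) - G z - t • B k)])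
  rw [Real.norm_eq_abs] at hmv
  convert hmv using 2
  simp [hf]
  ring

theorem hasGradientAt_of_abs_le_sq [CompleteSpace E] {e : E → ℝ} {g z : E} {C : ℝ}
    (h : ∀ y, |e y - e z - ⟪g, y - z⟫| ≤ C * ‖y - z‖ ^ 2) : HasGradientAt e g z := by
  rw [hasGradientAt_iff_isLittleO]
  have hO : (fun y => e y - e z - ⟪g, y - z⟫) =O[𝓝 z] fun y => ‖y - z‖ ^ 2 :=
    Asymptotics.IsBigO.of_bound C (Eventually.of_forall fun y => by
      rw [Real.norm_eq_abs, Real.norm_of_nonneg (by positivity)]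
      exact h y)
  have ho : (fun y => ‖y - z‖ ^ 2) =o[𝓝 z] fun y => y - z :=
    (Asymptotics.isLittleO_norm_pow_id one_lt_two).comp_tendsto
      (tendsto_sub_nhds_zero_iff.2 tendsto_id)
  exact hO.trans_isLittleO ho

/-- Properties of the proximal map of a convex function. -/
structure IsProx (H : E → ℝ) (J : E → E) : Prop where
  isSubgradient : ∀ z, IsSubgradient H (J z) (z - J z)

namespace IsProx

variable {H : E → ℝ} {J : E → E}

/-- Firm nonexpansiveness, which is monotonicity of the subdifferential read at `J z` and `J y`. -/
theorem firm (hJ : IsProx H J) (z y : E) : ‖J z - J y‖ ^ 2 ≤ ⟪J z - J y, z - y⟫ := by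
  have h := (hJ.isSubgradient z).inner_nonneg (hJ.isSubgradient y)
  rw [show z - J z - (y - J y) = (z - y) - (J z - J y) by abel, inner_sub_left,
    real_inner_self_eq_norm_sq, real_inner_comm] at h
  linarith

theorem norm_sub_le (hJ : IsProx H J) (z y : E) : ‖J z - J y‖ ≤ ‖z - y‖ := by
  have h := hJ.firm z y
  have h2 := real_inner_le_norm (J z - J y) (z - y)
  by_contra! hlt
  nlinarith [norm_nonneg (J z - J y), norm_nonneg (z - y)]

theorem lipschitz (hJ : IsProx H J) : LipschitzWith 1 J :=
  LipschitzWith.of_dist_le_mul fun z y => by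
    simpa [dist_eq_norm] using hJ.norm_sub_le z y

/-- Uniqueness of the proximal point. Since subgradients exist everywhere, this makes `J`
surjective. -/
theorem eq_of_isSubgradient (hJ : IsProx H J) {ξ v : E} (hv : IsSubgradient H ξ v) :
    J (ξ + v) = ξ := by
  have h := (hJ.isSubgradient (ξ + v)).inner_nonneg hv
  rw [show ξ + v - J (ξ + v) - v = -(J (ξ + v) - ξ) by abel, inner_neg_left,
    real_inner_self_eq_norm_sq] at h
  have : ‖J (ξ + v) - ξ‖ = 0 := by
    apply pow_eq_zero_iff (two_ne_zero) |>.1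
    nlinarith [sq_nonneg ‖J (ξ + v) - ξ‖]
  exact sub_eq_zero.1 (norm_eq_zero.1 this)

/-- The Moreau envelope of `H` has gradient `z - J z`. -/
theorem hasGradientAt_envelope (hJ : IsProx H J) [CompleteSpace E] (z : E) :
    HasGradientAt (fun z => H (J z) + 1 / 2 * ‖J z - z‖ ^ 2) (z - J z) z := by
  -- `J z` is a competitor in the minimum defining the envelope at `y`. Exchanging `z` and `y` gives
  -- the matching lower bound.
  have up : ∀ z y, H (J y) + 1 / 2 * ‖J y - y‖ ^ 2 ≤
      H (J z) + 1 / 2 * ‖J z - z‖ ^ 2 + ⟪z - J z, y - z⟫ + 1 / 2 * ‖y - z‖ ^ 2 := by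
    intro z y
    have h := hJ.isSubgradient y (J z)
    have e1 : ‖J z - z‖ ^ 2 + 2 * ⟪z - J z, y - z⟫ + ‖y - z‖ ^ 2 = ‖y - J z‖ ^ 2 := by
      rw [norm_sub_rev (J z) z, ← norm_add_sq_real]; congr 2; abel
    have e2 : ‖y - J z‖ ^ 2 = ‖J y - y‖ ^ 2 - 2 * ⟪y - J y, J z - J y⟫ + ‖J z - J y‖ ^ 2 := by
      rw [norm_sub_rev (J y) y, ← norm_sub_sq_real]; congr 2; abel
    nlinarith [sq_nonneg ‖J z - J y‖]
  refine hasGradientAt_of_abs_le_sq (C := 3) fun y => ?_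
  rw [abs_le]
  have h1 := up z y
  have h2 := up y z
  have h3 : ⟪y - J y, z - y⟫ = - ⟪z - J z, y - z⟫ - ⟪y - z, y - z⟫ + ⟪J y - J z, y - z⟫ := by
    rw [← neg_sub y z, inner_neg_right, ← inner_neg_left, ← inner_neg_left, ← inner_sub_left,
      ← inner_add_left]
    congr 1; abel
  rw [h3, real_inner_self_eq_norm_sq, norm_sub_rev z y] at h2
  have h4 := real_inner_le_norm (J y - J z) (y - z)
  have h5 := hJ.norm_sub_le y z
  have h6 : ‖J y - J z‖ * ‖y - z‖ ≤ ‖y - z‖ ^ 2 := by nlinarith [norm_nonneg (y - z)]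
  constructor <;> nlinarith [sq_nonneg ‖y - z‖]

/-- Where `J` is differentiable with an invertible derivative, its inverse is Lipschitz. -/
theorem exists_norm_le (hJ : IsProx H J) {z : E} {A B : E →L[ℝ] E} (hA : HasFDerivAt J A z)
    (hBA : ∀ k, B (A k) = k) :
    ∃ b > 0, ∃ r > 0, ∀ k, ‖J (z + k) - J z‖ < r → ‖k‖ ≤ b * ‖J (z + k) - J z‖ := by
  set b := ‖B‖ + 1 with hb
  have hb0 : 0 < b := by positivity
  have hle : ∀ k, ‖k‖ ≤ b * ‖A k‖ := by
    intro k
    have := B.le_opNorm (A k)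
    rw [hBA] at this
    nlinarith [norm_nonneg (A k)]
  have hlow := (hasFDerivAt_iff_isLittleO_nhds_zero.1 hA).def (c := 1 / (2 * b)) (by positivity)
  obtain ⟨r0, hr0, hball⟩ := Metric.eventually_nhds_iff.1 hlow
  have near : ∀ k, ‖k‖ < r0 → ‖k‖ ≤ 2 * b * ‖J (z + k) - J z‖ := by
    intro k hk
    have h1 := @hball k (by simpa using hk)
    have h2 := hle k
    have h3 : ‖A k‖ ≤ ‖J (z + k) - J z‖ + ‖J (z + k) - J z - A k‖ := by
      have := _root_.norm_sub_le (J (z + k) - J z) (J (z + k) - J z - A k)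
      rwa [show J (z + k) - J z - (J (z + k) - J z - A k) = A k by abel] at this
    have h4 : b * (1 / (2 * b) * ‖k‖) = ‖k‖ / 2 := by field_simp
    nlinarith
  -- The radius excludes large `k`: by monotonicity of `J` along the ray, `J (z + k)` close to `J z`
  -- would force `J (z + s • k)` close to `J z` for `‖s • k‖ = r0 / 2`, against `near`.
  refine ⟨2 * b, by positivity, r0 / 2 / (4 * b ^ 2), by positivity, fun k hk => ?_⟩
  by_cases hkr : ‖k‖ < r0
  · exact near k hkr
  exfalso
  push Not at hkr
  have hk0 : 0 < ‖k‖ := hr0.trans_le hkr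
  set s := r0 / 2 / ‖k‖ with hs
  have hs0 : 0 < s := by positivity
  have hs1 : s < 1 := by rw [hs, div_lt_one hk0]; linarith
  have hnorm : ‖s • k‖ = r0 / 2 := by
    rw [norm_smul, Real.norm_of_nonneg hs0.le, hs]; field_simp
  have h1 := near (s • k) (by rw [hnorm]; linarith)
  have h2 := hJ.firm (z + s • k) z
  have h3 := hJ.firm (z + k) (z + s • k)
  rw [show z + k - (z + s • k) = (1 - s) • k by module, inner_smul_right,
    show J (z + k) - J (z + s • k) = (J (z + k) - J z) - (J (z + s • k) - J z) by abel,
    inner_sub_left] at h3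
  rw [add_sub_cancel_left, inner_smul_right] at h2
  have h4 : ⟪J (z + s • k) - J z, k⟫ ≤ ⟪J (z + k) - J z, k⟫ := by
    have : 0 ≤ (1 - s) * (⟪J (z + k) - J z, k⟫ - ⟪J (z + s • k) - J z, k⟫) :=
      (sq_nonneg _).trans h3
    have := nonneg_of_mul_nonneg_right this (by linarith)
    linarith
  have h5 := real_inner_le_norm (J (z + k) - J z) k
  rw [hnorm] at h1
  set a := ‖J (z + s • k) - J z‖
  have h6 : a ^ 2 ≤ r0 / 2 * ‖J (z + k) - J z‖ := by
    calc a ^ 2 ≤ s * (‖J (z + k) - J z‖ * ‖k‖) := by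
          refine h2.trans (mul_le_mul_of_nonneg_left (h4.trans h5) hs0.le)
      _ = _ := by rw [hs]; field_simp
  have h7 : r0 / 2 * ‖J (z + k) - J z‖ < (r0 / 2) ^ 2 / (4 * b ^ 2) := by
    calc r0 / 2 * ‖J (z + k) - J z‖ < r0 / 2 * (r0 / 2 / (4 * b ^ 2)) :=
          mul_lt_mul_of_pos_left hk (by positivity)
      _ = _ := by ring
  have h8 : (r0 / 2) ^ 2 / (4 * b ^ 2) ≤ a ^ 2 := by
    rw [div_le_iff₀ (by positivity)]
    calc (r0 / 2) ^ 2 ≤ (2 * b * a) ^ 2 := by gcongr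
      _ = _ := by ring
  linarith

/-- Write a point near `J z` as `J (z + k) = J z + h`, so that `k = B h + o(h)`. The envelope has a
quadratic expansion at `z` because its gradient `z - J z` is differentiable there, and subtracting
the squared distance transfers it to `H`; the Hessian of `H` is the inverse derivative of `J` minus
the identity. -/
theorem hasQuadExpansion (hJ : IsProx H J) [CompleteSpace E] (hsurj : Function.Surjective J) {z : E}
    {A B : E →L[ℝ] E} (hA : HasFDerivAt J A z) (hBA : ∀ k, B (A k) = k) :
    HasQuadExpansion H (J z) (z - J z) (B - ContinuousLinearMap.id ℝ E) := by
  obtain ⟨b, hb, r, hr, hinv⟩ := hJ.exists_norm_le hA hBA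
  intro τ hτ
  -- Makes the three errors, from the envelope, from `k - B h` and from `h - A k`, add up to at most
  -- `τ * ‖h‖ ^ 2`.
  set μ := τ / (2 * b ^ 2 + ‖B‖ * b) with hμ
  have hμ0 : 0 < μ := by positivity
  have hE : HasQuadExpansion (fun z => H (J z) + 1 / 2 * ‖J z - z‖ ^ 2) z (z - J z)
      (ContinuousLinearMap.id ℝ E - A) := by
    have hd : HasFDerivAt (fun z => z - J z) (ContinuousLinearMap.id ℝ E - A) z :=
      (hasFDerivAt_id z).fun_sub hA
    exact hasQuadExpansion_of_hasFDerivAt_gradient (G := fun z => z - J z)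
      (fun y => hJ.hasGradientAt_envelope y) hd
  have hboth := (hE μ hμ0).and ((hasFDerivAt_iff_isLittleO_nhds_zero.1 hA).def hμ0)
  obtain ⟨r1, hr1, hball⟩ := Metric.eventually_nhds_iff.1 hboth
  refine Metric.eventually_nhds_iff.2 ⟨min r (r1 / b), by positivity, fun {h} hh => ?_⟩
  rw [dist_zero_right] at hh
  obtain ⟨y, hy⟩ := hsurj (J z + h)
  obtain ⟨k, rfl⟩ : ∃ k, y = z + k := ⟨y - z, by abel⟩
  have hh' : J (z + k) - J z = h := by rw [hy]; abel
  have hk := hinv k (by rw [hh']; exact hh.trans_le (min_le_left _ _))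
  rw [hh'] at hk
  obtain ⟨e1, e2⟩ := @hball k (by
    rw [dist_zero_right]
    refine hk.trans_lt ?_
    have := hh.trans_le (min_le_right _ _)
    rw [lt_div_iff₀ hb] at this
    linarith)
  rw [hh'] at e2
  have e3 : ‖k - B h‖ ≤ ‖B‖ * (μ * ‖k‖) := by
    have : k - B h = - B (h - A k) := by rw [map_sub, hBA]; abel
    rw [this, norm_neg]
    exact (B.le_opNorm _).trans (mul_le_mul_of_nonneg_left e2 (norm_nonneg _))
  have e4 : H (J z + h) - H (J z) - ⟪z - J z, h⟫ -
      1 / 2 * ⟪(B - ContinuousLinearMap.id ℝ E) h, h⟫ =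
      (H (J (z + k)) + 1 / 2 * ‖J (z + k) - (z + k)‖ ^ 2 - (H (J z) + 1 / 2 * ‖J z - z‖ ^ 2) -
        ⟪z - J z, k⟫ - 1 / 2 * ⟪(ContinuousLinearMap.id ℝ E - A) k, k⟫) +
      1 / 2 * ⟪k - B h, h⟫ + 1 / 2 * ⟪h - A k, k⟫ := by
    have f1 : ‖J (z + k) - (z + k)‖ ^ 2 = ‖J z - z‖ ^ 2 + 2 * ⟪z - J z, k⟫ - 2 * ⟪z - J z, h⟫
        + ‖k‖ ^ 2 - 2 * ⟪k, h⟫ + ‖h‖ ^ 2 := by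
      rw [hy, show J z + h - (z + k) = -((z - J z) + (k - h)) by abel, norm_neg,
        norm_add_sq_real, norm_sub_sq_real k h, inner_sub_right, norm_sub_rev z (J z)]
      ring
    rw [f1, hy]
    simp only [inner_sub_left, _root_.sub_apply, ContinuousLinearMap.id_apply,
      real_inner_self_eq_norm_sq, real_inner_comm h k]
    ring
  rw [e4]
  have g2 := abs_real_inner_le_norm (k - B h) h
  have g3 := abs_real_inner_le_norm (h - A k) k
  have k0 := norm_nonneg k
  have h0 := norm_nonneg h
  have B0 := norm_nonneg B
  have i1 : μ * ‖k‖ ^ 2 ≤ μ * (b * ‖h‖) ^ 2 := by gcongr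
  have i2 : ‖k - B h‖ * ‖h‖ ≤ ‖B‖ * (μ * (b * ‖h‖)) * ‖h‖ := by
    refine mul_le_mul_of_nonneg_right (e3.trans ?_) h0
    gcongr
  have i3 : ‖h - A k‖ * ‖k‖ ≤ μ * (b * ‖h‖) * (b * ‖h‖) :=
    mul_le_mul (e2.trans (by gcongr)) hk k0 (by positivity)
  have tot : μ * (b * ‖h‖) ^ 2 + ‖B‖ * (μ * (b * ‖h‖)) * ‖h‖ + μ * (b * ‖h‖) * (b * ‖h‖)
      = τ * ‖h‖ ^ 2 := by
    rw [hμ]; field_simp; ring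
  have n2 : 0 ≤ μ * (b * ‖h‖) * (b * ‖h‖) := by positivity
  have n3 : 0 ≤ ‖B‖ * (μ * (b * ‖h‖)) * ‖h‖ := by positivity
  refine (abs_add_three _ _ _).trans ?_
  rw [abs_mul, abs_mul, abs_of_pos (by norm_num : (0 : ℝ) < 1 / 2)]
  linarith

end IsProx

variable [FiniteDimensional ℝ E] [MeasurableSpace E] [BorelSpace E]

/-- **Alexandrov's theorem** for a convex function with bounded subgradients. -/
theorem exists_null_hasQuadExpansion_of_convex {H : E → ℝ} {R : ℝ}
    (hH : ∀ ξ, ∃ v, ‖v‖ ≤ R ∧ IsSubgradient H ξ v) :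
    ∃ N : Set E, μH[Module.finrank ℝ E] N = 0 ∧
      ∀ ξ ∉ N, ∃ q T, HasQuadExpansion H ξ q T := by
  choose J hJ' using exists_prox hH
  have hJ : IsProx H J := ⟨hJ'⟩
  have hsurj : Function.Surjective J := fun ξ => by
    obtain ⟨v, -, hv⟩ := hH ξ
    exact ⟨ξ + v, hJ.eq_of_isSubgradient hv⟩
  set D := {z | DifferentiableAt ℝ J z} with hD
  set Z := {z | DifferentiableAt ℝ J z ∧ (fderiv ℝ J z).det = 0} with hZ
  -- Points outside the domain of differentiability are null by Rademacher, and their image is null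
  -- since `J` is 1-Lipschitz; critical values are null by Sard's lemma.
  refine ⟨J '' Dᶜ ∪ J '' Z, ?_, fun ξ hξ => ?_⟩
  · rw [measure_union_null_iff]
    constructor
    · have h1 : μH[Module.finrank ℝ E] Dᶜ = 0 :=
        hJ.lipschitz.ae_differentiableAt (μ := μH[Module.finrank ℝ E])
      have h2 := hJ.lipschitz.hausdorffMeasure_image_le (d := Module.finrank ℝ E) (by positivity) Dᶜ
      rw [h1, mul_zero] at h2
      exact le_antisymm h2 (zero_le)
    · exact addHaar_image_eq_zero_of_det_fderivWithin_eq_zero _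
        (fun z hz => hz.1.hasFDerivAt.hasFDerivWithinAt) fun z hz => hz.2
  · obtain ⟨z, rfl⟩ := hsurj ξ
    have hz : DifferentiableAt ℝ J z := by
      by_contra hz
      exact hξ (Or.inl ⟨z, hz, rfl⟩)
    have hdet : (fderiv ℝ J z).det ≠ 0 := fun h0 => hξ (Or.inr ⟨z, ⟨hz, h0⟩, rfl⟩)
    set e := (fderiv ℝ J z).toContinuousLinearEquivOfDetNeZero hdet with he
    exact ⟨_, _, hJ.hasQuadExpansion hsurj (B := (e.symm : E →L[ℝ] E)) hz.hasFDerivAt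
      fun k => e.symm_apply_apply k⟩

end Convex

/-! ### Maxima of sums of semiconvex functions -/

section Semiconvex

variable {E : Type*} [NormedAddCommGroup E] [InnerProductSpace ℝ E]

theorem eventually_smul_of_eventually_nhds_zero {P : E → Prop} (hP : ∀ᶠ h in 𝓝 (0 : E), P h)
    (h : E) : ∃ r > 0, ∀ t : ℝ, 0 < t → t < r → P (t • h) := by
  have hc : Tendsto (fun t : ℝ => t • h) (𝓝 0) (𝓝 0) := by
    have : Continuous fun t : ℝ => t • h := by fun_prop
    simpa using this.tendsto 0
  obtain ⟨r, hr, hb⟩ := Metric.eventually_nhds_iff.1 (hc.eventually hP)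
  exact ⟨r, hr, fun t ht htr => hb (by rwa [dist_zero_right, Real.norm_of_nonneg ht.le])⟩

theorem eq_zero_of_eventually_inner_le {d : E} {C : ℝ}
    (hd : ∀ᶠ h in 𝓝 (0 : E), ⟪d, h⟫ ≤ C * ‖h‖ ^ 2) : d = 0 := by
  obtain ⟨r, hr, ht⟩ := eventually_smul_of_eventually_nhds_zero hd d
  by_contra hne
  have hd0 : 0 < ‖d‖ ^ 2 := by positivity
  set t := min (r / 2) (1 / (2 * (|C| + 1))) with htdef
  have ht0 : 0 < t := by positivity
  have h1 := ht t ht0 ((min_le_left _ _).trans_lt (by linarith))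
  rw [inner_smul_right, real_inner_self_eq_norm_sq, norm_smul, Real.norm_of_nonneg ht0.le] at h1
  have h2 : t * (|C| + 1) ≤ 1 / 2 := by
    calc t * (|C| + 1) ≤ 1 / (2 * (|C| + 1)) * (|C| + 1) :=
          mul_le_mul_of_nonneg_right (min_le_right _ _) (by positivity)
      _ = 1 / 2 := by field_simp
  have h3 : t * ‖d‖ ^ 2 * (1 - C * t) ≤ 0 := by nlinarith
  have h4 : C * t ≤ 1 / 2 := by nlinarith [le_abs_self C]
  nlinarith [mul_pos ht0 hd0]

/-- Both terms are 2-homogeneous, so the local inequality holds for every `h`; then `τ` tends to 0.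
-/
theorem inner_nonneg_of_eventually {A : E →L[ℝ] E}
    (hA : ∀ τ > 0, ∀ᶠ h in 𝓝 (0 : E), 0 ≤ ⟪A h, h⟫ + τ * ‖h‖ ^ 2) (h : E) : 0 ≤ ⟪A h, h⟫ := by
  have key : ∀ τ > 0, 0 ≤ ⟪A h, h⟫ + τ * ‖h‖ ^ 2 := by
    intro τ hτ
    obtain ⟨r, hr, ht⟩ := eventually_smul_of_eventually_nhds_zero (hA τ hτ) h
    have h1 := ht (r / 2) (by linarith) (by linarith)
    rw [map_smul, inner_smul_left, inner_smul_right, norm_smul, mul_pow, Real.norm_eq_abs,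
      sq_abs] at h1
    simp only [conj_trivial] at h1
    have h2 : 0 ≤ (r / 2) ^ 2 * (⟪A h, h⟫ + τ * ‖h‖ ^ 2) := by nlinarith
    exact nonneg_of_mul_nonneg_right h2 (by positivity)
  refine le_of_forall_pos_le_add fun ε hε => ?_
  have h1 := key (ε / (‖h‖ ^ 2 + 1)) (by positivity)
  have h2 : ε / (‖h‖ ^ 2 + 1) * ‖h‖ ^ 2 ≤ ε := by
    rw [div_mul_eq_mul_div, div_le_iff₀ (by positivity)]
    nlinarith
  linarith

/-- `S` is touched from below, at each point, by a paraboloid of opening `m` with vertex in the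
ball of radius `R`. -/
def BelowParaboloids (m R : ℝ) (S : E → ℝ) : Prop :=
  ∀ ξ, ∃ x, ‖x‖ ≤ R ∧ ∀ ζ, S ξ + m / 2 * ‖x - ξ‖ ^ 2 - m / 2 * ‖x - ζ‖ ^ 2 ≤ S ζ

/-- The paraboloid of opening `m` with gradient `v` at `ξ` touches `S` from below at `ξ`. -/
def TouchedBelow (m : ℝ) (S : E → ℝ) (ξ v : E) : Prop :=
  ∀ h, S ξ + ⟪v, h⟫ - m / 2 * ‖h‖ ^ 2 ≤ S (ξ + h)

theorem BelowParaboloids.exists_touchedBelow {m R : ℝ} {S : E → ℝ} (hS : BelowParaboloids m R S)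
    (ξ : E) : ∃ v, TouchedBelow m S ξ v := by
  obtain ⟨x, -, hx⟩ := hS ξ
  refine ⟨m • (x - ξ), fun h => ?_⟩
  have h1 := hx (ξ + h)
  rw [show x - (ξ + h) = (x - ξ) - h by abel, norm_sub_sq_real (x - ξ) h] at h1
  rw [real_inner_smul_left]
  linarith

/-- Expanding the squares turns the paraboloid with vertex `x` into an affine function of slope `x`.
This reduces semiconvex functions to convex ones with bounded subgradients. -/
theorem BelowParaboloids.exists_subgradient {m R : ℝ} (hm : 0 < m) {S : E → ℝ}
    (hS : BelowParaboloids m R S) (ξ : E) :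
    ∃ v, ‖v‖ ≤ R ∧ IsSubgradient (fun ξ => m⁻¹ * S ξ + 1 / 2 * ‖ξ‖ ^ 2) ξ v := by
  obtain ⟨x, hxR, hx⟩ := hS ξ
  refine ⟨x, hxR, fun ζ => ?_⟩
  have h1 := mul_le_mul_of_nonneg_left (hx ζ) (inv_pos.2 hm).le
  rw [norm_sub_sq_real, norm_sub_sq_real] at h1
  have h2 : m⁻¹ * (S ξ + m / 2 * (‖x‖ ^ 2 - 2 * ⟪x, ξ⟫ + ‖ξ‖ ^ 2) -
      m / 2 * (‖x‖ ^ 2 - 2 * ⟪x, ζ⟫ + ‖ζ‖ ^ 2)) =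
      m⁻¹ * S ξ + 1 / 2 * ‖ξ‖ ^ 2 + ⟪x, ζ⟫ - ⟪x, ξ⟫ - 1 / 2 * ‖ζ‖ ^ 2 := by
    field_simp; ring
  rw [h2] at h1
  simp only [inner_sub_right]
  linarith

theorem BelowParaboloids.continuous {m R : ℝ} (hm : 0 < m) {S : E → ℝ}
    (hS : BelowParaboloids m R S) : Continuous S := by
  have h1 := (lipschitz_of_bounded_subgradients (hS.exists_subgradient hm)).continuous
  have h2 : S = fun ξ => m * ((m⁻¹ * S ξ + 1 / 2 * ‖ξ‖ ^ 2) - 1 / 2 * ‖ξ‖ ^ 2) := by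
    ext ξ; field_simp; ring
  rw [h2]
  exact continuous_const.mul (h1.sub (by fun_prop))

/-- A paraboloid below and one above at the same point must have the same slope. All gradients later
on are identified in this way. -/
theorem TouchedBelow.eq_of_eventually_le {m C : ℝ} {S : E → ℝ} {ξ v q : E}
    (hv : TouchedBelow m S ξ v)
    (hq : ∀ᶠ h in 𝓝 (0 : E), S (ξ + h) ≤ S ξ + ⟪q, h⟫ + C * ‖h‖ ^ 2) : v = q := by
  refine sub_eq_zero.1 (eq_zero_of_eventually_inner_le (C := C + m / 2) ?_)
  filter_upwards [hq] with h hh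
  have := hv h
  rw [inner_sub_left]
  linarith

theorem HasQuadExpansion.eventually_le {S : E → ℝ} {ξ q : E} {T : E →L[ℝ] E}
    (hS : HasQuadExpansion S ξ q T) :
    ∀ᶠ h in 𝓝 (0 : E), S (ξ + h) ≤ S ξ + ⟪q, h⟫ + (1 + ‖T‖) * ‖h‖ ^ 2 := by
  filter_upwards [hS 1 one_pos] with h hh
  have h1 := (abs_le.1 hh).2
  have h2 := real_inner_le_norm (T h) h
  have h3 := T.le_opNorm h
  have h4 : ‖T h‖ * ‖h‖ ≤ ‖T‖ * ‖h‖ ^ 2 := by nlinarith [norm_nonneg h]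
  nlinarith [norm_nonneg T, sq_nonneg ‖h‖, mul_nonneg (norm_nonneg T) (sq_nonneg ‖h‖)]

theorem TouchedBelow.neg_le_inner {m : ℝ} {S : E → ℝ} {ξ q : E} {T : E →L[ℝ] E}
    (hv : TouchedBelow m S ξ q) (hS : HasQuadExpansion S ξ q T) (h : E) :
    -(m * ‖h‖ ^ 2) ≤ ⟪T h, h⟫ := by
  have := inner_nonneg_of_eventually (A := T + m • ContinuousLinearMap.id ℝ E) (fun τ hτ => by
    filter_upwards [hS (τ / 2) (by positivity)] with h hh
    have h1 := (abs_le.1 hh).2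
    have h2 := hv h
    simp only [_root_.add_apply, _root_.smul_apply, ContinuousLinearMap.id_apply, inner_add_left,
      real_inner_smul_left, real_inner_self_eq_norm_sq]
    linarith) h
  simp only [_root_.add_apply, _root_.smul_apply, ContinuousLinearMap.id_apply, inner_add_left,
    real_inner_smul_left, real_inner_self_eq_norm_sq] at this
  linarith

/-- Gradients of a semiconvex function near a point where it is touched from above. -/
theorem TouchedBelow.norm_sub_le {m C : ℝ} {S : E → ℝ} {ξ p d q : E}
    (hlow : TouchedBelow m S ξ p)
    (hup : ∀ h, ‖h‖ ≤ 1 → S (ξ + h) ≤ S ξ + ⟪p, h⟫ + C * ‖h‖ ^ 2)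
    (hq : TouchedBelow m S (ξ + d) q) (hm : 0 ≤ m) (hC : 0 ≤ C) {r : ℝ} (hr : 0 < r)
    (hr2 : r ≤ 1 / 2) (hd : ‖d‖ ≤ r) : ‖q - p‖ ≤ (4 * C + m) * r := by
  rcases eq_or_ne (q - p) 0 with h0 | h0
  · rw [h0, norm_zero]; positivity
  -- A step of length `r` along `q - p` makes the gradient gap visible as `r * ‖q - p‖`; `r ≤ 1 / 2`
  -- keeps `d + h` in the unit ball.
  set h := (r / ‖q - p‖) • (q - p) with hh
  have hqp : 0 < ‖q - p‖ := norm_pos_iff.2 h0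
  have hnorm : ‖h‖ = r := by
    rw [hh, norm_smul, Real.norm_of_nonneg (by positivity)]; field_simp
  have hinner : ⟪q - p, h⟫ = r * ‖q - p‖ := by
    rw [hh, inner_smul_right, real_inner_self_eq_norm_sq]; field_simp
  have hdh : ‖d + h‖ ≤ 2 * r := (norm_add_le _ _).trans (by linarith)
  have h1 := hq h
  have h2 := hup (d + h) (by linarith)
  have h3 := hlow d
  rw [← add_assoc, inner_add_right] at h2
  rw [inner_sub_left] at hinner
  rw [hnorm] at h1
  have h4 : ‖d + h‖ ^ 2 ≤ (2 * r) ^ 2 := by gcongr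
  have h5 : ‖d‖ ^ 2 ≤ r ^ 2 := by gcongr
  have h6 : C * ‖d + h‖ ^ 2 ≤ C * (2 * r) ^ 2 := by gcongr
  have h7 : m / 2 * ‖d‖ ^ 2 ≤ m / 2 * r ^ 2 := by gcongr
  have h8 : r * ‖q - p‖ ≤ r * ((4 * C + m) * r) := by nlinarith
  exact le_of_mul_le_mul_left h8 hr

variable [FiniteDimensional ℝ E] [MeasurableSpace E] [BorelSpace E]

/-- **Alexandrov's theorem** for semiconvex functions. -/
theorem BelowParaboloids.exists_null_hasQuadExpansion {m R : ℝ} (hm : 0 < m) {S : E → ℝ}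
    (hS : BelowParaboloids m R S) :
    ∃ N : Set E, μH[Module.finrank ℝ E] N = 0 ∧ ∀ ξ ∉ N, ∃ (q : E) (T : E →L[ℝ] E),
      (T : E →ₗ[ℝ] E).IsSymmetric ∧ HasQuadExpansion S ξ q T := by
  obtain ⟨N, hN, hexp⟩ := exists_null_hasQuadExpansion_of_convex (hS.exists_subgradient hm)
  refine ⟨N, hN, fun ξ hξ => ?_⟩
  obtain ⟨q, T, hT⟩ := hexp ξ hξ
  -- Undoes the convexification. The operator from the resolvent need not be known symmetric, so its
  -- symmetric part is taken; the quadratic form is unchanged.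
  refine ⟨m • q - m • ξ, (m / 2) • (T + ContinuousLinearMap.adjoint T) -
    m • ContinuousLinearMap.id ℝ E, fun a b => ?_, fun τ hτ => ?_⟩
  · simp only [ContinuousLinearMap.coe_coe, _root_.sub_apply, _root_.smul_apply, _root_.add_apply,
      ContinuousLinearMap.id_apply, inner_sub_left, inner_sub_right, real_inner_smul_left,
      real_inner_smul_right, inner_add_left, inner_add_right,
      ContinuousLinearMap.adjoint_inner_left, ContinuousLinearMap.adjoint_inner_right]
    ring
  · filter_upwards [hT (τ / m) (by positivity)] with h hh
    simp only [_root_.sub_apply, _root_.smul_apply, _root_.add_apply,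
      ContinuousLinearMap.id_apply, inner_sub_left, real_inner_smul_left, inner_add_left,
      ContinuousLinearMap.adjoint_inner_left]
    have h1 := mul_le_mul_of_nonneg_left hh hm.le
    rw [← abs_of_pos hm, ← abs_mul, abs_of_pos hm] at h1
    refine (le_of_eq ?_).trans (h1.trans (le_of_eq ?_))
    · congr 1
      rw [norm_add_sq_real, real_inner_self_eq_norm_sq, real_inner_comm h (T h)]
      field_simp
      ring
    · field_simp

/-- **Jensen's lemma**: small linear perturbations of a semiconvex function with a strict maximum
have their maxima outside of any given null set. -/
theorem exists_perturbed_max_notMem {m : ℝ} {g : E → ℝ} (hg : Continuous g)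
    (hsc : ∀ ξ, ∃ v, TouchedBelow m g ξ v) (hm : 0 ≤ m) {η₀ : E} (hmax : ∀ η, g η ≤ g η₀)
    {N : Set E} (hN : μH[Module.finrank ℝ E] N = 0) {δ ρ : ℝ} (hδ : 0 < δ) (hρ : 0 < ρ) :
    ∃ p η, ‖p‖ < ρ ∧ η ∉ N ∧ δ * ‖η - η₀‖ ≤ ‖p‖ ∧
      ∀ ζ, g ζ - δ * ‖ζ - η₀‖ ^ 2 - ⟪p, ζ⟫ ≤ g η - δ * ‖η - η₀‖ ^ 2 - ⟪p, η⟫ := by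
  have : ProperSpace E := FiniteDimensional.proper ℝ E
  have bound : ∀ p η : E, g η₀ - δ * ‖η₀ - η₀‖ ^ 2 - ⟪p, η₀⟫ ≤ g η - δ * ‖η - η₀‖ ^ 2 - ⟪p, η⟫ →
      δ * ‖η - η₀‖ ≤ ‖p‖ := by
    intro p η h
    have h1 := hmax η
    have h2 := neg_le_of_abs_le (abs_real_inner_le_norm p (η - η₀))
    rw [inner_sub_right] at h2
    rw [sub_self, norm_zero] at h
    by_contra! hlt
    have h3 : 0 < ‖η - η₀‖ := by
      by_contra! h0
      nlinarith [norm_nonneg p]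
    nlinarith
  have hex : ∀ p, ∃ η, ∀ ζ, g ζ - δ * ‖ζ - η₀‖ ^ 2 - ⟪p, ζ⟫ ≤ g η - δ * ‖η - η₀‖ ^ 2 - ⟪p, η⟫ := by
    intro p
    have hc : Continuous fun η => g η - δ * ‖η - η₀‖ ^ 2 - ⟪p, η⟫ := by fun_prop
    refine hc.exists_forall_ge_of_isBounded η₀ ?_
    refine (Metric.isBounded_closedBall (x := η₀) (r := ‖p‖ / δ)).subset fun η hη => ?_
    rw [Metric.mem_closedBall, dist_eq_norm, le_div_iff₀ hδ, mul_comm]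
    exact bound p η hη
  choose η hη using hex
  set M := m + 2 * δ with hM
  have hMpos : 0 < M := by positivity
  -- Maximality determines the slope: the perturbed function without its linear term has slope
  -- exactly `p` at `η p`, and is touched there from below with opening `M`.
  have hlow : ∀ p h, g (η p) - δ * ‖η p - η₀‖ ^ 2 + ⟪p, h⟫ - M / 2 * ‖h‖ ^ 2 ≤
      g (η p + h) - δ * ‖η p + h - η₀‖ ^ 2 := by
    intro p
    obtain ⟨v, hv⟩ := hsc (η p)
    have e : ∀ h, ‖η p + h - η₀‖ ^ 2 = ‖η p - η₀‖ ^ 2 + 2 * ⟪η p - η₀, h⟫ + ‖h‖ ^ 2 := by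
      intro h
      rw [show η p + h - η₀ = (η p - η₀) + h by abel, norm_add_sq_real]
    have hvp : v = p + (2 * δ) • (η p - η₀) := by
      refine hv.eq_of_eventually_le (C := δ) (Eventually.of_forall fun h => ?_)
      have h1 := hη p (η p + h)
      rw [e, inner_add_right] at h1
      rw [inner_add_left, real_inner_smul_left]
      linarith
    intro h
    have h1 := hv h
    rw [hvp, inner_add_left, real_inner_smul_left] at h1
    rw [e]
    rw [hM]
    nlinarith
  -- Distinct slopes need distant maximisers: compare the paraboloid at `η p'` with maximality at `η
  -- p`, after the optimal step `M⁻¹ • (p' - p)`.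
  have hanti : AntilipschitzWith (2 * M).toNNReal η := by
    refine AntilipschitzWith.of_le_mul_dist fun p p' => ?_
    rw [Real.coe_toNNReal _ (by positivity), dist_eq_norm, dist_eq_norm]
    rcases eq_or_ne p p' with rfl | hne
    · simp
    have hpos : 0 < ‖p - p'‖ := norm_pos_iff.2 (sub_ne_zero.2 hne)
    have h1 := hlow p' (M⁻¹ • (p' - p))
    have h2 := hη p (η p' + M⁻¹ • (p' - p))
    have h3 := hη p' (η p)
    have h4 : ⟪p' - p, M⁻¹ • (p' - p)⟫ = M⁻¹ * ‖p - p'‖ ^ 2 := by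
      rw [inner_smul_right, real_inner_self_eq_norm_sq, norm_sub_rev]
    have h5 : ‖M⁻¹ • (p' - p)‖ ^ 2 = M⁻¹ ^ 2 * ‖p - p'‖ ^ 2 := by
      rw [norm_smul, mul_pow, Real.norm_eq_abs, sq_abs, norm_sub_rev]
    rw [h5] at h1
    rw [inner_sub_left] at h4
    rw [inner_add_right] at h2
    have h6 := real_inner_le_norm (p - p') (η p' - η p)
    rw [inner_sub_left, inner_sub_right, inner_sub_right, norm_sub_rev (η p')] at h6
    have h7 : M / 2 * (M⁻¹ ^ 2 * ‖p - p'‖ ^ 2) = M⁻¹ / 2 * ‖p - p'‖ ^ 2 := by field_simp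
    have h8 : M⁻¹ / 2 * ‖p - p'‖ ^ 2 ≤ ‖p - p'‖ * ‖η p - η p'‖ := by linarith
    have h9 : ‖p - p'‖ * ‖p - p'‖ ≤ ‖p - p'‖ * (2 * M * ‖η p - η p'‖) := by
      have := mul_le_mul_of_nonneg_left h8 (by positivity : 0 ≤ 2 * M)
      calc _ = 2 * M * (M⁻¹ / 2 * ‖p - p'‖ ^ 2) := by field_simp
        _ ≤ _ := this
        _ = _ := by ring
    exact le_of_mul_le_mul_left h9 hpos
  by_contra! hcon
  -- Otherwise a ball of slopes would lie in the preimage of `N`, which is null because `η` is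
  -- antilipschitz.
  have hsub : Metric.ball (0 : E) ρ ⊆ η ⁻¹' N := by
    intro p hp
    by_contra hmem
    obtain ⟨ζ, hζ⟩ := hcon p (η p) (by simpa using hp) hmem (bound p _ (hη p η₀))
    exact absurd (hη p ζ) (not_le.2 hζ)
  have h1 := hanti.hausdorffMeasure_preimage_le (d := Module.finrank ℝ E) (by positivity) N
  rw [hN, mul_zero] at h1
  have h2 : 0 < μH[Module.finrank ℝ E] (Metric.ball (0 : E) ρ) := Metric.measure_ball_pos _ _ hρ
  exact absurd (h2.trans_le (measure_mono hsub)) (not_lt.2 h1)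

/-- At a maximum of `S₁ ξ + S₂ η - φ (ξ - η)` with semiconvex `S₁`, `S₂`, there are nearby points
with second order expansions whose Hessians are ordered. -/
theorem exists_hasQuadExpansion_pair {m R : ℝ} (hm : 0 < m) {S₁ S₂ : E → ℝ}
    (h₁ : BelowParaboloids m R S₁) (h₂ : BelowParaboloids m R S₂) {φ : E → ℝ} {η₀ z p : E} {C : ℝ}
    (hC : 0 ≤ C)
    (hmax : ∀ ξ η, S₁ ξ + S₂ η - φ (ξ - η) ≤ S₁ (η₀ + z) + S₂ η₀ - φ z)
    (hφ : ∀ h, ‖h‖ ≤ 1 → φ (z + h) ≤ φ z + ⟪p, h⟫ + C * ‖h‖ ^ 2) {ε δ : ℝ} (hε : 0 < ε)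
    (hδ : 0 < δ) :
    ∃ (η q₁ q₂ : E) (T₁ T₂ : E →L[ℝ] E), S₁ (η₀ + z) + S₂ η₀ - ε ≤ S₁ (η + z) + S₂ η ∧
      ‖q₁ - p‖ ≤ ε ∧ ‖q₂ + p‖ ≤ ε ∧
      (T₁ : E →ₗ[ℝ] E).IsSymmetric ∧ (T₂ : E →ₗ[ℝ] E).IsSymmetric ∧
      HasQuadExpansion S₁ (η + z) q₁ T₁ ∧ HasQuadExpansion S₂ η q₂ T₂ ∧
      (∀ h, -(m * ‖h‖ ^ 2) ≤ ⟪T₁ h, h⟫) ∧ (∀ h, -(m * ‖h‖ ^ 2) ≤ ⟪T₂ h, h⟫) ∧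
      ∀ h, ⟪T₁ h, h⟫ + ⟪T₂ h, h⟫ ≤ 2 * δ * ‖h‖ ^ 2 := by
  obtain ⟨N₁, hN₁, hexp₁⟩ := h₁.exists_null_hasQuadExpansion hm
  obtain ⟨N₂, hN₂, hexp₂⟩ := h₂.exists_null_hasQuadExpansion hm
  -- The difference of the two points stays equal to `z`, so the penalty is constant and a null set
  -- of `η` in `E` suffices, without doubling the dimension.
  set N := (fun η => η + z) ⁻¹' N₁ ∪ N₂ with hNdef
  have hN : μH[Module.finrank ℝ E] N = 0 := by
    rw [hNdef, measure_union_null_iff]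
    exact ⟨by rw [measure_preimage_add_right, hN₁], hN₂⟩
  set r := min (1 / 2) (ε / (4 * C + m)) with hr
  have hr0 : 0 < r := by positivity
  have hrε : (4 * C + m) * r ≤ ε := by
    calc (4 * C + m) * r ≤ (4 * C + m) * (ε / (4 * C + m)) :=
          mul_le_mul_of_nonneg_left (min_le_right _ _) (by positivity)
      _ = ε := by field_simp
  have c₁ := h₁.continuous hm
  have c₂ := h₂.continuous hm
  obtain ⟨p', η, hp', hηN, hηp, hη⟩ := exists_perturbed_max_notMem (m := 2 * m)
    (g := fun η => S₁ (η + z) + S₂ η) (by fun_prop) (fun ξ => by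
      obtain ⟨v₁, hv₁⟩ := h₁.exists_touchedBelow (ξ + z)
      obtain ⟨v₂, hv₂⟩ := h₂.exists_touchedBelow ξ
      refine ⟨v₁ + v₂, fun h => ?_⟩
      have i1 := hv₁ h
      have i2 := hv₂ h
      rw [show ξ + z + h = ξ + h + z by abel] at i1
      rw [inner_add_left]
      linarith) (by positivity) (η₀ := η₀) (fun η => by
      have := hmax (η + z) η
      rw [add_sub_cancel_left] at this
      linarith) hN hδ (ρ := min (δ * r) ε) (by positivity)
  rw [hNdef, Set.mem_union, not_or] at hηN
  obtain ⟨q₁, T₁, hs₁, he₁⟩ := hexp₁ (η + z) hηN.1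
  obtain ⟨q₂, T₂, hs₂, he₂⟩ := hexp₂ η hηN.2
  have hd : ‖η - η₀‖ ≤ r := by
    have : δ * ‖η - η₀‖ ≤ δ * r := hηp.trans (hp'.le.trans (min_le_left _ _))
    exact le_of_mul_le_mul_left this hδ
  have t₁ : TouchedBelow m S₁ (η + z) q₁ := by
    obtain ⟨v, hv⟩ := h₁.exists_touchedBelow (η + z)
    rwa [hv.eq_of_eventually_le he₁.eventually_le] at hv
  have t₂ : TouchedBelow m S₂ η q₂ := by
    obtain ⟨v, hv⟩ := h₂.exists_touchedBelow η
    rwa [hv.eq_of_eventually_le he₂.eventually_le] at hv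
  have up₁ : ∀ h, ‖h‖ ≤ 1 → S₁ (η₀ + z + h) ≤ S₁ (η₀ + z) + ⟪p, h⟫ + C * ‖h‖ ^ 2 := by
    intro h hh
    have i1 := hmax (η₀ + z + h) η₀
    rw [show η₀ + z + h - η₀ = z + h by abel] at i1
    have i2 := hφ h hh
    linarith
  have up₂ : ∀ h, ‖h‖ ≤ 1 → S₂ (η₀ + h) ≤ S₂ η₀ + ⟪-p, h⟫ + C * ‖h‖ ^ 2 := by
    intro h hh
    have i1 := hmax (η₀ + z) (η₀ + h)
    rw [show η₀ + z - (η₀ + h) = z + -h by abel] at i1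
    have i2 := hφ (-h) (by rwa [norm_neg])
    rw [norm_neg, inner_neg_right] at i2
    rw [inner_neg_left]
    linarith
  have hball : ∀ᶠ h in 𝓝 (0 : E), ‖h‖ ≤ 1 := by
    filter_upwards [Metric.closedBall_mem_nhds (0 : E) one_pos] with h hh
    simpa using hh
  have t₁' : TouchedBelow m S₁ (η₀ + z) p := by
    obtain ⟨v, hv⟩ := h₁.exists_touchedBelow (η₀ + z)
    rwa [hv.eq_of_eventually_le (hball.mono up₁)] at hv
  have t₂' : TouchedBelow m S₂ η₀ (-p) := by
    obtain ⟨v, hv⟩ := h₂.exists_touchedBelow η₀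
    rwa [hv.eq_of_eventually_le (hball.mono up₂)] at hv
  have e₀ : ∀ h, S₁ (η + z + h) + S₂ (η + h) - (S₁ (η + z) + S₂ η) ≤
      ⟪(2 * δ) • (η - η₀) + p', h⟫ + δ * ‖h‖ ^ 2 := by
    intro h
    have i1 := hη (η + h)
    rw [show η + h - η₀ = (η - η₀) + h by abel, norm_add_sq_real, inner_add_right,
      show η + h + z = η + z + h by abel] at i1
    rw [inner_add_left, real_inner_smul_left]
    linarith
  -- The first order terms agree with those of the perturbation, so only second order terms remain
  -- in the bound on `T₁ + T₂`.
  have hq : q₁ + q₂ - ((2 * δ) • (η - η₀) + p') = 0 := by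
    refine eq_zero_of_eventually_inner_le (C := δ + m) (Eventually.of_forall fun h => ?_)
    have i1 := e₀ h
    have i2 := t₁ h
    have i3 := t₂ h
    rw [inner_sub_left, inner_add_left]
    linarith
  refine ⟨η, q₁, q₂, T₁, T₂, ?_, ?_, ?_, hs₁, hs₂, he₁, he₂, t₁.neg_le_inner he₁,
    t₂.neg_le_inner he₂, fun h => ?_⟩
  · have i1 := hη η₀
    have i2 := neg_le_of_abs_le (abs_real_inner_le_norm p' (η - η₀))
    rw [sub_self, norm_zero] at i1
    rw [inner_sub_right] at i2
    have i3 : ‖p'‖ * ‖η - η₀‖ ≤ ε * 1 := by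
      refine mul_le_mul (hp'.le.trans (min_le_right _ _)) ?_ (norm_nonneg _) hε.le
      exact hd.trans ((min_le_left _ _).trans (by norm_num))
    have i4 : 0 ≤ δ * ‖η - η₀‖ ^ 2 := by positivity
    linarith
  · refine (TouchedBelow.norm_sub_le (d := η - η₀) t₁' up₁ ?_ hm.le hC hr0 (min_le_left _ _)
      hd).trans hrε
    rwa [show η₀ + z + (η - η₀) = η + z by abel]
  · have := TouchedBelow.norm_sub_le (d := η - η₀) (q := q₂) t₂' up₂ (by rwa [add_sub_cancel])
      hm.le hC hr0 (min_le_left _ _) hd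
    rw [sub_neg_eq_add] at this
    exact this.trans hrε
  · have := inner_nonneg_of_eventually
      (A := (2 * δ) • ContinuousLinearMap.id ℝ E - T₁ - T₂) (fun τ hτ => by
      filter_upwards [he₁ (τ / 4) (by positivity), he₂ (τ / 4) (by positivity)] with h g1 g2
      have j1 := (abs_le.1 g1).1
      have j2 := (abs_le.1 g2).1
      have j3 := e₀ h
      rw [← sub_eq_zero.1 hq, inner_add_left] at j3
      simp only [_root_.sub_apply, _root_.smul_apply, ContinuousLinearMap.id_apply, inner_sub_left,
        real_inner_smul_left, real_inner_self_eq_norm_sq]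
      linarith) h
    simp only [_root_.sub_apply, _root_.smul_apply, ContinuousLinearMap.id_apply, inner_sub_left,
      real_inner_smul_left, real_inner_self_eq_norm_sq] at this
    linarith

end Semiconvex

/-! ### The nonlinearity -/

section Nonlinearity

variable {n : ℕ}

/-- Used to see that orthogonal conjugation preserves the eigenvalue constraints. -/
theorem orderedEigenvalue_eq_of_charpoly_eq {a b : Matrix (Fin n) (Fin n) ℝ} (ha : a.IsHermitian)
    (hb : b.IsHermitian) (h : a.charpoly = b.charpoly) (i : ℕ) :
    orderedEigenvalue a i = orderedEigenvalue b i := by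
  have h0 : ha.eigenvalues₀ = hb.eigenvalues₀ := by
    simp_rw [← List.ofFn_inj, ← IsHermitian.sort_roots_charpoly_eq_eigenvalues₀, h]
  unfold orderedEigenvalue
  by_cases hi : 1 ≤ i ∧ i ≤ n
  · rw [dif_pos ⟨ha, hi⟩, dif_pos ⟨hb, hi⟩, h0]
  · rw [dif_neg (fun h => hi h.2), dif_neg (fun h => hi h.2)]

theorem trace_le_of_orderedEigenvalue_le (hn : 0 < n) {L : ℝ} {a : Matrix (Fin n) (Fin n) ℝ}
    (ha : a.IsHermitian) (haL : orderedEigenvalue a 1 ≤ L) : a.trace ≤ n * L := by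
  rw [orderedEigenvalue, dif_pos ⟨ha, le_rfl, hn⟩] at haL
  rw [ha.trace_eq_sum_eigenvalues]
  have : ∀ i, ha.eigenvalues i ≤ L := fun i =>
    (ha.eigenvalues₀_antitone (Fin.mk_le_of_le_val (Nat.zero_le _))).trans haL
  calc ∑ i, (ha.eigenvalues i : ℝ) ≤ ∑ _i : Fin n, L := Finset.sum_le_sum fun i _ => this i
    _ = n * L := by simp

/-- Testing on `e_i ± e_j` gives `2 * |a i j| ≤ a i i + a j j`. -/
theorem abs_apply_le_trace {a : Matrix (Fin n) (Fin n) ℝ} (ha : a.PosSemidef) (i j : Fin n) :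
    |a i j| ≤ a.trace := by
  have hsymm : a j i = a i j := by simpa using ha.1.apply i j
  have hdiag : ∀ l, 0 ≤ a l l := fun l => ha.diag_nonneg
  have hle : ∀ l, a l l ≤ a.trace := fun l =>
    Finset.single_le_sum (f := fun l => a l l) (fun l _ => hdiag l) (Finset.mem_univ l)
  have key : ∀ c : ℝ, 0 ≤ a i i + 2 * c * a i j + c ^ 2 * a j j := by
    intro c
    have := ha.dotProduct_mulVec_nonneg (Pi.single i 1 + c • Pi.single j 1)
    simp only [star_trivial, mulVec_add, mulVec_smul, add_dotProduct, dotProduct_add,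
      smul_dotProduct, dotProduct_smul, mulVec_single_one, single_one_dotProduct, col_apply,
      smul_eq_mul, hsymm] at this
    linarith
  have h1 := key 1
  have h2 := key (-1)
  have h3 := hle i
  have h4 := hle j
  rw [abs_le]
  constructor <;> linarith

theorem abs_trace_mul_le {M a : Matrix (Fin n) (Fin n) ℝ} {B A : ℝ} (hB : 0 ≤ B)
    (hM : ∀ i j, |M i j| ≤ B) (ha : ∀ i j, |a i j| ≤ A) :
    |(M * a).trace| ≤ n ^ 2 * (B * A) := by
  calc |(M * a).trace| = |∑ i, ∑ j, M i j * a j i| := by simp [trace, mul_apply]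
    _ ≤ ∑ i, ∑ j, |M i j * a j i| :=
        (Finset.abs_sum_le_sum_abs _ _).trans
          (Finset.sum_le_sum fun i _ => Finset.abs_sum_le_sum_abs _ _)
    _ ≤ ∑ _i : Fin n, ∑ _j : Fin n, B * A :=
        Finset.sum_le_sum fun i _ => Finset.sum_le_sum fun j _ => by
          rw [abs_mul]
          exact mul_le_mul (hM i j) (ha j i) (abs_nonneg _) hB
    _ = n ^ 2 * (B * A) := by simp; ring

/-- With `a = Cᴴ * C`, the trace is that of `C * P * Cᴴ`. This is the source of degenerate
ellipticity. -/
theorem trace_mul_nonneg {P a : Matrix (Fin n) (Fin n) ℝ} (hP : P.PosSemidef) (ha : a.PosSemidef) :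
    0 ≤ (P * a).trace := by
  obtain ⟨C, rfl⟩ : ∃ C, a = Cᴴ * C := by
    open scoped MatrixOrder in
    exact CStarAlgebra.nonneg_iff_eq_star_mul_self.1 ha.nonneg
  rw [← Matrix.mul_assoc, trace_mul_comm, ← Matrix.mul_assoc]
  exact (hP.mul_mul_conjTranspose_same C).trace_nonneg

theorem abs_apply_le_of_mem_admissible (hn : 0 < n) {k : ℕ} {L : ℝ} {p : EuclideanSpace ℝ (Fin n)}
    {a : Matrix (Fin n) (Fin n) ℝ} (ha : a ∈ admissible k L p) (i j : Fin n) :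
    |a i j| ≤ n * L :=
  (abs_apply_le_trace ha.1 i j).trans (trace_le_of_orderedEigenvalue_le hn ha.1.1 ha.2.2.2)

theorem nonlin_le (hn : 0 < n) {k : ℕ} {L : ℝ} {p : EuclideanSpace ℝ (Fin n)}
    {M a : Matrix (Fin n) (Fin n) ℝ} (ha : a ∈ admissible k L p) :
    nonlin k L (p, M) ≤ -(1 / 2 : ℝ) * (M * a).trace := by
  obtain ⟨B, hB⟩ : ∃ B, ∀ i j, |M i j| ≤ B := by
    refine ⟨∑ i, ∑ j, |M i j|, fun i j => ?_⟩
    exact (Finset.single_le_sum (f := fun j => |M i j|) (fun _ _ => abs_nonneg _)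
      (Finset.mem_univ j)).trans (Finset.single_le_sum (f := fun i => ∑ j, |M i j|)
        (fun _ _ => Finset.sum_nonneg fun _ _ => abs_nonneg _) (Finset.mem_univ i))
  have hB0 : 0 ≤ B := (abs_nonneg _).trans (hB ⟨0, hn⟩ ⟨0, hn⟩)
  refine csInf_le ⟨-(n ^ 2 * (B * (n * L))), ?_⟩ ⟨a, ha, rfl⟩
  rintro _ ⟨b, hb, rfl⟩
  have h1 := abs_trace_mul_le hB0 hB (abs_apply_le_of_mem_admissible hn hb)
  have h2 := abs_le.1 h1
  have h3 := (abs_nonneg _).trans h1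
  simp only
  linarith

theorem abs_nonlin_le (hn : 0 < n) {k : ℕ} {L : ℝ} (hL : 0 ≤ L) {p : EuclideanSpace ℝ (Fin n)}
    {M : Matrix (Fin n) (Fin n) ℝ} {B : ℝ} (hB : ∀ i j, |M i j| ≤ B) :
    |nonlin k L (p, M)| ≤ n ^ 3 * L * B := by
  have hB0 : 0 ≤ B := (abs_nonneg _).trans (hB ⟨0, hn⟩ ⟨0, hn⟩)
  have hb : ∀ b ∈ admissible k L p, |-(1 / 2 : ℝ) * (M * b).trace| ≤ n ^ 3 * L * B := by
    intro b hb
    have h1 := abs_trace_mul_le hB0 hB (abs_apply_le_of_mem_admissible hn hb)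
    have h3 := (abs_nonneg _).trans h1
    rw [abs_mul, abs_neg, abs_of_pos (by norm_num : (0 : ℝ) < 1 / 2)]
    have h4 : (n : ℝ) ^ 2 * (B * (n * L)) = n ^ 3 * L * B := by ring
    linarith
  -- For an empty admissible set the infimum is 0 by convention and the bound still holds.
  rcases (admissible k L p).eq_empty_or_nonempty with he | ⟨b, hbm⟩
  · simp only [nonlin, he, Set.image_empty, Real.sInf_empty, abs_zero]
    positivity
  rw [abs_le]
  refine ⟨le_csInf ⟨_, b, hbm, rfl⟩ ?_, (nonlin_le hn hbm).trans (abs_le.1 (hb b hbm)).2⟩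
  rintro _ ⟨c, hc, rfl⟩
  exact (abs_le.1 (hb c hc)).1

theorem admissible_smul (k : ℕ) (L : ℝ) {s : ℝ} (hs : s ≠ 0) (p : EuclideanSpace ℝ (Fin n)) :
    admissible k L (s • p) = admissible k L p := by
  ext a
  simp [admissible, mulVec_smul, hs]

/-- The homogeneity that makes `s * u` a strict subsolution. -/
theorem nonlin_smul (k : ℕ) (L : ℝ) {s : ℝ} (hs : 0 < s) (p : EuclideanSpace ℝ (Fin n))
    (M : Matrix (Fin n) (Fin n) ℝ) :
    nonlin k L (s • p, s • M) = s * nonlin k L (p, M) := by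
  simp only [nonlin, admissible_smul k L hs.ne']
  rw [← smul_eq_mul s (sInf _), ← Real.sInf_smul_of_nonneg hs.le]
  congr 1
  rw [← Set.image_smul, Set.image_image]
  refine Set.image_congr fun a _ => ?_
  simp only [smul_mul, trace_smul, smul_eq_mul]
  ring

/-! ### Rotations and continuity of the nonlinearity away from `p = 0` -/

/-- The reflection in the hyperplane orthogonal to `v`. -/
def reflMatrix (v : Fin n → ℝ) : Matrix (Fin n) (Fin n) ℝ :=
  1 - (2 / (v ⬝ᵥ v)) • vecMulVec v v

theorem reflMatrix_transpose (v : Fin n → ℝ) : (reflMatrix v)ᵀ = reflMatrix v := by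
  simp [reflMatrix, transpose_vecMulVec]

theorem reflMatrix_mulVec (v x : Fin n → ℝ) :
    reflMatrix v *ᵥ x = x - (2 * (v ⬝ᵥ x) / (v ⬝ᵥ v)) • v := by
  simp only [reflMatrix, sub_mulVec, one_mulVec, smul_mulVec, vecMulVec_mulVec]
  congr 1
  ext i
  simp
  ring

theorem reflMatrix_mul_self {v : Fin n → ℝ} (hv : v ⬝ᵥ v ≠ 0) :
    reflMatrix v * reflMatrix v = 1 := by
  simp only [reflMatrix, mul_sub, sub_mul, Matrix.mul_one, Matrix.one_mul, Matrix.smul_mul,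
    Matrix.mul_smul,    vecMulVec_mul_vecMulVec, smul_smul]
  ext i j
  simp [vecMulVec_apply]
  field_simp
  ring

theorem reflMatrix_smul {c : ℝ} (hc : c ≠ 0) (v : Fin n → ℝ) :
    reflMatrix (c • v) = reflMatrix v := by
  ext i j
  simp only [reflMatrix, Matrix.sub_apply, Matrix.smul_apply, vecMulVec_apply, Pi.smul_apply, smul_eq_mul,
    dotProduct_smul, smul_dotProduct]
  congr 1
  by_cases hv : v ⬝ᵥ v = 0
  · simp [hv]
  · field_simp

/-- The vector bisecting the directions of `p` and `q`. -/
def bisector (p q : EuclideanSpace ℝ (Fin n)) : Fin n → ℝ :=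
  ‖q‖ • p.ofLp + ‖p‖ • q.ofLp

/-- A rotation taking the direction of `p` to the direction of `q`. -/
def rotMatrix (p q : EuclideanSpace ℝ (Fin n)) : Matrix (Fin n) (Fin n) ℝ :=
  reflMatrix (bisector p q) * reflMatrix p.ofLp

theorem dotProduct_self_eq_norm_sq (p : EuclideanSpace ℝ (Fin n)) :
    p.ofLp ⬝ᵥ p.ofLp = ‖p‖ ^ 2 := by
  rw [EuclideanSpace.norm_sq_eq]
  simp [dotProduct, sq]

/-- The reflection along the bisector takes `q` to a negative multiple of `p`, and the reflection
along `p` restores the sign. -/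
theorem rotMatrix_transpose_mulVec {p q : EuclideanSpace ℝ (Fin n)} (hp : p ≠ 0)
    (hb : bisector p q ⬝ᵥ bisector p q ≠ 0) :
    (rotMatrix p q)ᵀ *ᵥ q.ofLp = (‖q‖ / ‖p‖) • p.ofLp := by
  have hp0 : ‖p‖ ≠ 0 := norm_ne_zero_iff.2 hp
  have e1 : bisector p q ⬝ᵥ q.ofLp * (2 * ‖p‖) = bisector p q ⬝ᵥ bisector p q := by
    simp only [bisector, add_dotProduct, dotProduct_add, smul_dotProduct, dotProduct_smul,
      smul_eq_mul, dotProduct_self_eq_norm_sq, dotProduct_comm q.ofLp p.ofLp]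
    ring
  have e2 : 2 * (bisector p q ⬝ᵥ q.ofLp) / (bisector p q ⬝ᵥ bisector p q) = 1 / ‖p‖ := by
    rw [div_eq_div_iff hb hp0, ← e1]; ring
  have e3 : reflMatrix (bisector p q) *ᵥ q.ofLp = (-(‖q‖ / ‖p‖)) • p.ofLp := by
    rw [reflMatrix_mulVec, e2]
    ext i
    simp [bisector]
    field_simp
    ring
  rw [rotMatrix, transpose_mul, reflMatrix_transpose, reflMatrix_transpose, ← mulVec_mulVec, e3,
    mulVec_smul, reflMatrix_mulVec, mul_div_assoc, div_self (by
      rw [dotProduct_self_eq_norm_sq]; positivity)]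
  ext i
  simp
  ring

theorem rotMatrix_transpose_mul_self {p q : EuclideanSpace ℝ (Fin n)} (hp : p ≠ 0)
    (hb : bisector p q ⬝ᵥ bisector p q ≠ 0) : (rotMatrix p q)ᵀ * rotMatrix p q = 1 := by
  have hp' : p.ofLp ⬝ᵥ p.ofLp ≠ 0 := by
    rw [dotProduct_self_eq_norm_sq]; exact pow_ne_zero _ (norm_ne_zero_iff.2 hp)
  rw [rotMatrix, transpose_mul, reflMatrix_transpose, reflMatrix_transpose, Matrix.mul_assoc,
    ← Matrix.mul_assoc (reflMatrix (bisector p q)), reflMatrix_mul_self hb, Matrix.one_mul,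
    reflMatrix_mul_self hp']

/-- Orthogonal conjugation keeps the spectrum and carries the kernel condition from `p` to `q`. -/
theorem rotMatrix_conj_mem_admissible {k : ℕ} {L : ℝ} {p q : EuclideanSpace ℝ (Fin n)}
    (hp : p ≠ 0) (hb : bisector p q ⬝ᵥ bisector p q ≠ 0) {a : Matrix (Fin n) (Fin n) ℝ}
    (ha : a ∈ admissible k L p) :
    rotMatrix p q * a * (rotMatrix p q)ᵀ ∈ admissible k L q := by
  have hpsd : (rotMatrix p q * a * (rotMatrix p q)ᵀ).PosSemidef := by
    have := ha.1.mul_mul_conjTranspose_same (rotMatrix p q)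
    rwa [conjTranspose_eq_transpose_of_trivial] at this
  have hchar : (rotMatrix p q * a * (rotMatrix p q)ᵀ).charpoly = a.charpoly := by
    rw [charpoly_mul_comm, ← Matrix.mul_assoc, rotMatrix_transpose_mul_self hp hb, Matrix.one_mul]
  have heig := orderedEigenvalue_eq_of_charpoly_eq hpsd.1 ha.1.1 hchar
  refine ⟨hpsd, ?_, by rw [heig]; exact ha.2.2.1, by rw [heig]; exact ha.2.2.2⟩
  rw [← mulVec_mulVec, rotMatrix_transpose_mulVec hp hb, mulVec_smul, ← mulVec_mulVec, ha.2.1,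
    mulVec_zero, smul_zero]

theorem abs_conj_sub_le {R a : Matrix (Fin n) (Fin n) ℝ} {d A : ℝ} (hd : 0 ≤ d)
    (hR : ∀ i l j k, |R i l * R j k - (1 : Matrix (Fin n) (Fin n) ℝ) i l *
      (1 : Matrix (Fin n) (Fin n) ℝ) j k| ≤ d)
    (ha : ∀ i j, |a i j| ≤ A) (i j : Fin n) : |(R * a * Rᵀ - a) i j| ≤ n ^ 2 * (d * A) := by
  have expand : ∀ Q : Matrix (Fin n) (Fin n) ℝ,
      (Q * a * Qᵀ) i j = ∑ k, ∑ l, Q i l * Q j k * a l k := by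
    intro Q
    simp only [mul_apply, transpose_apply, Finset.sum_mul]
    exact Finset.sum_congr rfl fun k _ => Finset.sum_congr rfl fun l _ => by ring
  have h1 : (R * a * Rᵀ - a) i j = ∑ k, ∑ l, (R i l * R j k -
      (1 : Matrix (Fin n) (Fin n) ℝ) i l * (1 : Matrix (Fin n) (Fin n) ℝ) j k) * a l k := by
    have h2 := expand 1
    rw [transpose_one, Matrix.mul_one, Matrix.one_mul] at h2
    rw [Matrix.sub_apply, expand R, h2]
    simp only [← Finset.sum_sub_distrib, sub_mul]
  rw [h1]
  calc _ ≤ ∑ k, ∑ l, |(R i l * R j k -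
      (1 : Matrix (Fin n) (Fin n) ℝ) i l * (1 : Matrix (Fin n) (Fin n) ℝ) j k) * a l k| :=
        (Finset.abs_sum_le_sum_abs _ _).trans
          (Finset.sum_le_sum fun i _ => Finset.abs_sum_le_sum_abs _ _)
    _ ≤ ∑ _k : Fin n, ∑ _l : Fin n, d * A :=
        Finset.sum_le_sum fun k _ => Finset.sum_le_sum fun l _ => by
          rw [abs_mul]
          exact mul_le_mul (hR i l j k) (ha l k) (abs_nonneg _) hd
    _ = n ^ 2 * (d * A) := by simp; ring

theorem bisector_self_ne_zero {p : EuclideanSpace ℝ (Fin n)} (hp : p ≠ 0) :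
    bisector p p ⬝ᵥ bisector p p ≠ 0 := by
  have hp0 : ‖p‖ ≠ 0 := norm_ne_zero_iff.2 hp
  rw [bisector, ← two_smul ℝ, smul_dotProduct, dotProduct_smul, smul_dotProduct, dotProduct_smul,
    dotProduct_self_eq_norm_sq]
  simp [hp]

/-- At `q = p` the two reflections coincide and cancel. A single reflection exchanging the two
directions would degenerate as `q` tends to `p`. -/
theorem rotMatrix_self {p : EuclideanSpace ℝ (Fin n)} (hp : p ≠ 0) : rotMatrix p p = 1 := by
  have hp0 : ‖p‖ ≠ 0 := norm_ne_zero_iff.2 hp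
  rw [rotMatrix, bisector, ← two_smul ℝ, smul_smul, reflMatrix_smul (by simpa using hp)]
  exact reflMatrix_mul_self (by rw [dotProduct_self_eq_norm_sq]; positivity)

theorem continuous_bisector :
    Continuous fun r : EuclideanSpace ℝ (Fin n) × EuclideanSpace ℝ (Fin n) =>
      bisector r.1 r.2 := by
  unfold bisector
  fun_prop

theorem continuousAt_reflMatrix {v : Fin n → ℝ} (hv : v ⬝ᵥ v ≠ 0) :
    ContinuousAt reflMatrix v := by
  have h1 : ContinuousAt (fun v : Fin n → ℝ => v ⬝ᵥ v) v :=
    (continuous_id.dotProduct continuous_id).continuousAt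
  have h2 : Continuous (fun v : Fin n → ℝ => vecMulVec v v) :=
    continuous_id.matrix_vecMulVec continuous_id
  exact continuousAt_const.sub ((continuousAt_const.div h1 hv).smul h2.continuousAt)

theorem continuousAt_rotMatrix {p : EuclideanSpace ℝ (Fin n)} (hp : p ≠ 0) :
    ContinuousAt (fun r : EuclideanSpace ℝ (Fin n) × EuclideanSpace ℝ (Fin n) =>
      rotMatrix r.1 r.2) (p, p) := by
  have h1 : ContinuousAt (fun r : EuclideanSpace ℝ (Fin n) × EuclideanSpace ℝ (Fin n) =>
      reflMatrix (bisector r.1 r.2)) (p, p) :=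
    (continuousAt_reflMatrix (bisector_self_ne_zero hp)).tendsto.comp
      (continuous_bisector.tendsto (p, p))
  have h2 : ContinuousAt (fun r : EuclideanSpace ℝ (Fin n) × EuclideanSpace ℝ (Fin n) =>
      reflMatrix r.1.ofLp) (p, p) := by
    have h3 : p.ofLp ⬝ᵥ p.ofLp ≠ 0 := by
      rw [dotProduct_self_eq_norm_sq]
      exact pow_ne_zero _ (norm_ne_zero_iff.2 hp)
    have h4 : Continuous fun r : EuclideanSpace ℝ (Fin n) × EuclideanSpace ℝ (Fin n) =>
      r.1.ofLp := by fun_prop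
    exact (continuousAt_reflMatrix h3).tendsto.comp (h4.tendsto (p, p))
  exact ContinuousAt.mul h1 h2

/-- Away from `p = 0` the nonlinearity is degenerate elliptic and continuous, locally uniformly. -/
theorem exists_nonlin_le_add (hn : 0 < n) {k : ℕ} {L : ℝ} (hL : 0 ≤ L)
    {p₀ : EuclideanSpace ℝ (Fin n)} (hp₀ : p₀ ≠ 0) {B τ : ℝ} (hB : 0 ≤ B) (hτ : 0 < τ) :
    ∃ ρ > 0, ∀ p q : EuclideanSpace ℝ (Fin n), ∀ X Y : Matrix (Fin n) (Fin n) ℝ,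
      ‖p - p₀‖ < ρ → ‖q - p₀‖ < ρ → (∀ i j, |X i j| ≤ B) →
      (Y - X + ρ • (1 : Matrix (Fin n) (Fin n) ℝ)).PosSemidef →
      nonlin k L (q, Y) ≤ nonlin k L (p, X) + τ := by
  -- Chosen so that replacing `a` by its rotated copy changes the trace against `X` by at most `τ`;
  -- the matrix shift `ρ` also costs at most `τ`, and the factor `1 / 2` absorbs the doubling.
  set d := τ / (n ^ 5 * L * B + 1) with hd
  have hd0 : 0 < d := by positivity
  have hR := continuousAt_rotMatrix hp₀
  have hev : ∀ᶠ r : EuclideanSpace ℝ (Fin n) × EuclideanSpace ℝ (Fin n) in 𝓝 (p₀, p₀),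
      (r.1 ≠ 0 ∧ bisector r.1 r.2 ⬝ᵥ bisector r.1 r.2 ≠ 0) ∧
      ∀ i l j m, |rotMatrix r.1 r.2 i l * rotMatrix r.1 r.2 j m -
        (1 : Matrix (Fin n) (Fin n) ℝ) i l * (1 : Matrix (Fin n) (Fin n) ℝ) j m| ≤ d := by
    refine ((continuous_fst.continuousAt.eventually_ne hp₀).and ?_).and ?_
    · exact (continuous_bisector.dotProduct continuous_bisector).continuousAt.eventually_ne
        (bisector_self_ne_zero hp₀)
    · simp only [eventually_all]
      intro i l j m
      have hent : ∀ i l, Tendsto (fun r : EuclideanSpace ℝ (Fin n) × EuclideanSpace ℝ (Fin n) =>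
          rotMatrix r.1 r.2 i l) (𝓝 (p₀, p₀)) (𝓝 ((1 : Matrix (Fin n) (Fin n) ℝ) i l)) := by
        intro i l
        have h1 : Continuous fun M : Matrix (Fin n) (Fin n) ℝ => M i l := by fun_prop
        have h2 := h1.continuousAt.tendsto.comp hR
        simpa [Function.comp_def, rotMatrix_self hp₀] using h2
      have h3 := ((hent i l).mul (hent j m)).sub_const
        ((1 : Matrix (Fin n) (Fin n) ℝ) i l * (1 : Matrix (Fin n) (Fin n) ℝ) j m)
      rw [sub_self] at h3
      filter_upwards [h3 (Metric.closedBall_mem_nhds 0 hd0)] with r hr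
      simpa [Real.norm_eq_abs] using hr
  obtain ⟨ρ, hρ, hball⟩ := Metric.eventually_nhds_iff.1 hev
  refine ⟨min ρ (τ / (n * L + 1)), by positivity, fun p q X Y hp hq hX hY => ?_⟩
  have near : ∀ p q : EuclideanSpace ℝ (Fin n), ‖p - p₀‖ < min ρ (τ / (n * L + 1)) →
      ‖q - p₀‖ < min ρ (τ / (n * L + 1)) → dist (p, q) (p₀, p₀) < ρ := by
    intro p q hp hq
    rw [Prod.dist_eq, max_lt_iff, dist_eq_norm, dist_eq_norm]
    exact ⟨hp.trans_le (min_le_left _ _), hq.trans_le (min_le_left _ _)⟩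
  obtain ⟨⟨hp0, hbis⟩, hrot⟩ := @hball (p, q) (near p q hp hq)
  obtain ⟨⟨hq0, hbis'⟩, -⟩ := @hball (q, p) (near q p hq hp)
  rcases (admissible k L p).eq_empty_or_nonempty with he | hne
  · have he' : admissible k L q = ∅ := by
      by_contra hne
      obtain ⟨a, ha⟩ := Set.nonempty_iff_ne_empty.2 hne
      have := rotMatrix_conj_mem_admissible hq0 hbis' ha
      rw [he] at this
      exact this
    simp only [nonlin, he, he', Set.image_empty, Real.sInf_empty]
    linarith
  rw [← sub_le_iff_le_add]
  refine le_csInf (hne.image _) ?_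
  rintro _ ⟨a, ha, rfl⟩
  have ha' := rotMatrix_conj_mem_admissible hp0 hbis ha
  set a' := rotMatrix p q * a * (rotMatrix p q)ᵀ with ha'def
  have h1 := nonlin_le hn (M := Y) ha'
  have h2 := trace_mul_nonneg hY ha'.1
  rw [add_mul, sub_mul, trace_add, trace_sub, smul_mul, Matrix.one_mul, trace_smul,
    smul_eq_mul] at h2
  have h3 : a'.trace ≤ n * L := trace_le_of_orderedEigenvalue_le hn ha'.1.1 ha'.2.2.2
  have h4 : min ρ (τ / (n * L + 1)) * a'.trace ≤ τ := by
    calc min ρ (τ / (n * L + 1)) * a'.trace ≤ τ / (n * L + 1) * (n * L + 1) :=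
          mul_le_mul (min_le_right _ _) (by linarith) ha'.1.trace_nonneg (by positivity)
      _ = τ := by field_simp
  have h5 : |(X * (a' - a)).trace| ≤ n ^ 2 * (B * (n ^ 2 * (d * (n * L)))) :=
    abs_trace_mul_le hB hX
      (abs_conj_sub_le hd0.le hrot (abs_apply_le_of_mem_admissible hn ha))
  rw [mul_sub, trace_sub] at h5
  have h6 : (n : ℝ) ^ 2 * (B * (n ^ 2 * (d * (n * L)))) ≤ τ := by
    calc (n : ℝ) ^ 2 * (B * (n ^ 2 * (d * (n * L)))) = d * (n ^ 5 * L * B) := by ring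
      _ ≤ d * (n ^ 5 * L * B + 1) := by gcongr; linarith
      _ = τ := by rw [hd]; field_simp
  have h7 := (abs_le.1 h5).1
  simp only
  linarith

end Nonlinearity

/-! ### Envelopes and test functions -/

section Envelopes

theorem isBoundedUnder_nhdsWithin {X : Type*} [TopologicalSpace X] {S : Set X} {f : X → ℝ} {C : ℝ}
    (hC : ∀ x ∈ S, |f x| ≤ C) (x : X) :
    (𝓝[S] x).IsBoundedUnder (· ≤ ·) f ∧ (𝓝[S] x).IsBoundedUnder (· ≥ ·) f :=
  ⟨⟨C, by
    rw [eventually_map]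
    filter_upwards [self_mem_nhdsWithin] with y hy using (abs_le.1 (hC y hy)).2⟩,
  ⟨-C, by
    rw [eventually_map]
    filter_upwards [self_mem_nhdsWithin] with y hy using (abs_le.1 (hC y hy)).1⟩⟩

/-- The filter within `S` includes `x` itself, which gives one inequality; boundedness keeps the
real `limsup` from taking a default value. -/
theorem uscEnv_eq {X : Type*} [TopologicalSpace X] {S : Set X} {f : X → ℝ}
    (hf : UpperSemicontinuousOn f S) {C : ℝ} (hC : ∀ x ∈ S, |f x| ≤ C) {x : X} (hx : x ∈ S) :
    uscEnv S f x = f x := by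
  have : (𝓝[S] x).NeBot := nhdsWithin_neBot_of_mem hx
  obtain ⟨hb1, hb2⟩ := isBoundedUnder_nhdsWithin hC x
  refine le_antisymm ?_ ?_
  · refine le_of_forall_pos_le_add fun ε hε => ?_
    refine limsup_le_of_le hb2.isCoboundedUnder_le ?_
    exact (hf x hx (f x + ε) (by linarith)).mono fun y hy => hy.le
  · refine le_limsup_of_frequently_le ?_ hb1
    exact Frequently.filter_mono (f := pure x) (frequently_pure.2 le_rfl) (pure_le_nhdsWithin hx)

theorem lscEnv_eq {X : Type*} [TopologicalSpace X] {S : Set X} {f : X → ℝ}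
    (hf : LowerSemicontinuousOn f S) {C : ℝ} (hC : ∀ x ∈ S, |f x| ≤ C) {x : X} (hx : x ∈ S) :
    lscEnv S f x = f x := by
  have : (𝓝[S] x).NeBot := nhdsWithin_neBot_of_mem hx
  obtain ⟨hb1, hb2⟩ := isBoundedUnder_nhdsWithin hC x
  refine le_antisymm ?_ ?_
  · refine liminf_le_of_frequently_le ?_ hb2
    exact Frequently.filter_mono (f := pure x) (frequently_pure.2 le_rfl) (pure_le_nhdsWithin hx)
  · refine le_of_forall_pos_sub_le fun ε hε => ?_
    refine le_liminf_of_le hb1.isCoboundedUnder_ge ?_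
    exact (hf x hx (f x - ε) (by linarith)).mono fun y hy => hy.le

variable {n : ℕ}

theorem eventually_near (q : EuclideanSpace ℝ (Fin n)) (M : Matrix (Fin n) (Fin n) ℝ) {ρ : ℝ}
    (hρ : 0 < ρ) : ∀ᶠ r in 𝓝[symDomain n] (q, M),
      r.2.IsSymm ∧ ‖r.1 - q‖ < ρ ∧ ∀ i j, |r.2 i j - M i j| < ρ := by
  refine Filter.Eventually.and self_mem_nhdsWithin (nhdsWithin_le_nhds ?_)
  refine Filter.Eventually.and ?_ ?_
  · have h1 : Continuous fun r : EuclideanSpace ℝ (Fin n) × Matrix (Fin n) (Fin n) ℝ =>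
      ‖r.1 - q‖ := by fun_prop
    exact (h1.tendsto (q, M)).eventually_lt_const (by simpa using hρ)
  · simp only [eventually_all]
    intro i j
    have h1 : Continuous fun r : EuclideanSpace ℝ (Fin n) × Matrix (Fin n) (Fin n) ℝ =>
      |r.2 i j - M i j| := by fun_prop
    exact (h1.tendsto (q, M)).eventually_lt_const (by simpa using hρ)

theorem isBoundedUnder_nonlin (hn : 0 < n) (k : ℕ) {L : ℝ} (hL : 0 ≤ L)
    (q : EuclideanSpace ℝ (Fin n)) (M : Matrix (Fin n) (Fin n) ℝ) :
    (𝓝[symDomain n] (q, M)).IsBoundedUnder (· ≤ ·) (nonlin k L) ∧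
      (𝓝[symDomain n] (q, M)).IsBoundedUnder (· ≥ ·) (nonlin k L) := by
  have hev : ∀ᶠ r in 𝓝[symDomain n] (q, M),
      |nonlin k L r| ≤ n ^ 3 * L * (1 + ∑ i, ∑ j, |M i j|) := by
    filter_upwards [eventually_near q M one_pos] with r hr
    refine abs_nonlin_le hn hL fun i j => ?_
    have h1 : |M i j| ≤ ∑ i, ∑ j, |M i j| :=
      (Finset.single_le_sum (f := fun j => |M i j|) (fun _ _ => abs_nonneg _)
        (Finset.mem_univ j)).trans (Finset.single_le_sum (f := fun i => ∑ j, |M i j|)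
        (fun _ _ => Finset.sum_nonneg fun _ _ => abs_nonneg _) (Finset.mem_univ i))
    have h2 := abs_sub_abs_le_abs_sub (r.2 i j) (M i j)
    have h3 := hr.2.2 i j
    linarith
  exact ⟨⟨_, eventually_map.2 (hev.mono fun r hr => (abs_le.1 hr).2)⟩,
    ⟨_, eventually_map.2 (hev.mono fun r hr => (abs_le.1 hr).1)⟩⟩

/-- Trades the envelope for an actual value of `F` at a nearby symmetric argument. -/
theorem exists_nonlin_lt_of_nonlinLower_lt (hn : 0 < n) {k : ℕ} {L : ℝ} (hL : 0 ≤ L)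
    {q : EuclideanSpace ℝ (Fin n)} {M : Matrix (Fin n) (Fin n) ℝ} (hM : M.IsSymm) {b : ℝ}
    (hb : nonlinLower k L q M < b) {ρ : ℝ} (hρ : 0 < ρ) :
    ∃ p X, ‖p - q‖ < ρ ∧ (∀ i j, |X i j - M i j| < ρ) ∧ X.IsSymm ∧ nonlin k L (p, X) < b := by
  have : (𝓝[symDomain n] (q, M)).NeBot := nhdsWithin_neBot_of_mem hM
  have h1 := frequently_lt_of_liminf_lt
    (isBoundedUnder_nonlin hn k hL q M).1.isCoboundedUnder_ge hb
  obtain ⟨r, hr1, hr2⟩ := (h1.and_eventually (eventually_near q M hρ)).exists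
  exact ⟨r.1, r.2, hr2.2.1, hr2.2.2, hr2.1, hr1⟩

theorem exists_lt_nonlin_of_lt_nonlinUpper (hn : 0 < n) {k : ℕ} {L : ℝ} (hL : 0 ≤ L)
    {q : EuclideanSpace ℝ (Fin n)} {M : Matrix (Fin n) (Fin n) ℝ} (hM : M.IsSymm) {b : ℝ}
    (hb : b < nonlinUpper k L q M) {ρ : ℝ} (hρ : 0 < ρ) :
    ∃ p X, ‖p - q‖ < ρ ∧ (∀ i j, |X i j - M i j| < ρ) ∧ X.IsSymm ∧ b < nonlin k L (p, X) := by
  have : (𝓝[symDomain n] (q, M)).NeBot := nhdsWithin_neBot_of_mem hM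
  have h1 := frequently_lt_of_lt_limsup
    (isBoundedUnder_nonlin hn k hL q M).2.isCoboundedUnder_le hb
  obtain ⟨r, hr1, hr2⟩ := (h1.and_eventually (eventually_near q M hρ)).exists
  exact ⟨r.1, r.2, hr2.2.1, hr2.2.2, hr2.1, hr1⟩

/-- The matrix of the bilinear form `⟪T x, y⟫`. -/
def formMatrix (T : EuclideanSpace ℝ (Fin n) →L[ℝ] EuclideanSpace ℝ (Fin n)) :
    Matrix (Fin n) (Fin n) ℝ :=
  Matrix.of fun i j => ⟪T (EuclideanSpace.single i 1), EuclideanSpace.single j 1⟫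

section TestFunction

variable {E : Type*} [NormedAddCommGroup E] [InnerProductSpace ℝ E]

/-- A quartic polynomial with prescribed gradient and Hessian at `x`. -/
def testFun (x q : E) (T : E →L[ℝ] E) (C : ℝ) (y : E) : ℝ :=
  ⟪q, y - x⟫ + 1 / 2 * ⟪T (y - x), y - x⟫ + C * (‖y - x‖ ^ 2) ^ 2

theorem contDiff_testFun (x q : E) (T : E →L[ℝ] E) (C : ℝ) : ContDiff ℝ 2 (testFun x q T C) := by
  have h1 : ContDiff ℝ 2 fun y : E => y - x := by fun_prop
  have h2 : ContDiff ℝ 2 fun y : E => T (y - x) := T.contDiff.comp h1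
  exact ((contDiff_const.inner ℝ h1).add (contDiff_const.mul (h2.inner ℝ h1))).add
    (contDiff_const.mul ((h1.norm_sq ℝ).pow 2))

theorem hasFDerivAt_testFun (x q : E) {T : E →L[ℝ] E} (hT : (T : E →ₗ[ℝ] E).IsSymmetric) (C : ℝ)
    (y : E) : HasFDerivAt (testFun x q T C)
      (innerSL ℝ (q + T (y - x) + (4 * C * ‖y - x‖ ^ 2) • (y - x))) y := by
  have h1 : HasFDerivAt (fun y : E => y - x) (ContinuousLinearMap.id ℝ E) y :=
    (hasFDerivAt_id y).sub_const x
  have h2 : HasFDerivAt (fun y : E => T (y - x)) (T.comp (ContinuousLinearMap.id ℝ E)) y :=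
    T.hasFDerivAt.comp y h1
  have h3 : HasFDerivAt (testFun x q T C) _ y :=
    (((hasFDerivAt_const q y).inner ℝ h1).fun_add ((h2.inner ℝ h1).const_mul (1 / 2))).fun_add
      ((HasFDerivAt.pow h1.norm_sq 2).const_mul C)
  refine h3.congr_fderiv ?_
  ext h
  have hs : ⟪T h, y - x⟫ = ⟪T (y - x), h⟫ := by
    rw [real_inner_comm]
    exact (hT (y - x) h).symm
  simp only [_root_.add_apply, _root_.smul_apply, ContinuousLinearMap.comp_apply,
    ContinuousLinearMap.prod_apply, fderivInnerCLM_apply, ContinuousLinearMap.id_apply,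
    _root_.zero_apply, inner_zero_left, innerSL_apply_apply, inner_add_left,
    real_inner_smul_left, hs, smul_eq_mul, nsmul_eq_mul]
  push_cast
  ring

theorem fderiv_fderiv_testFun (x q : E) {T : E →L[ℝ] E} (hT : (T : E →ₗ[ℝ] E).IsSymmetric) (C : ℝ) :
    fderiv ℝ (fderiv ℝ (testFun x q T C)) x = (innerSL ℝ).comp T := by
  have h0 : fderiv ℝ (testFun x q T C) =
      fun y => innerSL ℝ (q + T (y - x) + (4 * C * ‖y - x‖ ^ 2) • (y - x)) := by
    ext1 y
    exact (hasFDerivAt_testFun x q hT C y).fderiv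
  rw [h0]
  have h1 : HasFDerivAt (fun y : E => y - x) (ContinuousLinearMap.id ℝ E) x :=
    (hasFDerivAt_id x).sub_const x
  have h2 : HasFDerivAt (fun y : E => T (y - x)) (T.comp (ContinuousLinearMap.id ℝ E)) x :=
    T.hasFDerivAt.comp x h1
  have h3 := (h1.norm_sq.const_mul (4 * C)).fun_smul h1
  have h4 := (innerSL ℝ (E := E)).hasFDerivAt.comp x ((h2.const_add q).fun_add h3)
  refine (h4.congr_fderiv ?_).fderiv
  ext a b
  simp
  rfl

/-- A function bounded on `K` with an upper second order expansion at `x` lies below a quartic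
polynomial. -/
theorem exists_le_testFun {K : Set E} {v : E → ℝ} {C : ℝ} (hC : ∀ y ∈ K, |v y| ≤ C) {x : E}
    (hx : x ∈ K) (q : E) (T : E →L[ℝ] E)
    (h : ∀ᶠ h in 𝓝 (0 : E), x + h ∈ K → v (x + h) ≤ v x + ⟪q, h⟫ + 1 / 2 * ⟪T h, h⟫) :
    ∃ D, ∀ y ∈ K, v y - testFun x q T D y ≤ v x - testFun x q T D x := by
  obtain ⟨r, hr, hball⟩ := Metric.eventually_nhds_iff.1 h
  have hC0 : 0 ≤ C := (abs_nonneg _).trans (hC x hx)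
  -- For `‖h‖ ≥ r` the three summands dominate the oscillation of `v`, the linear term and the
  -- quadratic term respectively.
  refine ⟨2 * C / r ^ 4 + ‖q‖ / r ^ 3 + ‖T‖ / r ^ 2, fun y hy => ?_⟩
  obtain ⟨h, rfl⟩ : ∃ h, y = x + h := ⟨y - x, by abel⟩
  simp only [testFun, add_sub_cancel_left, sub_self, inner_zero_right, norm_zero, map_zero]
  by_cases hh : ‖h‖ < r
  · have h1 := @hball h (by simpa using hh) hy
    have h2 : 0 ≤ (2 * C / r ^ 4 + ‖q‖ / r ^ 3 + ‖T‖ / r ^ 2) * (‖h‖ ^ 2) ^ 2 := by positivity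
    norm_num
    linarith
  push Not at hh
  have h1 := (abs_le.1 (hC _ hy)).2
  have h2 := (abs_le.1 (hC _ hx)).1
  have h3 := neg_le_of_abs_le (abs_real_inner_le_norm q h)
  have h4 : -(‖T‖ * ‖h‖ ^ 2) ≤ ⟪T h, h⟫ := by
    have i1 := neg_le_of_abs_le (abs_real_inner_le_norm (T h) h)
    have i2 := mul_le_mul_of_nonneg_right (T.le_opNorm h) (norm_nonneg h)
    linarith
  have hs : 1 ≤ ‖h‖ / r := by rwa [le_div_iff₀ hr, one_mul]
  set s := ‖h‖ / r with hsdef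
  have hhs : ‖h‖ = s * r := by rw [hsdef]; field_simp
  have e : (2 * C / r ^ 4 + ‖q‖ / r ^ 3 + ‖T‖ / r ^ 2) * (‖h‖ ^ 2) ^ 2 =
      2 * C * s ^ 4 + ‖q‖ * ‖h‖ * s ^ 3 + ‖T‖ * ‖h‖ ^ 2 * s ^ 2 := by
    rw [hhs]; field_simp
  rw [e]
  have g1 : 2 * C * 1 ≤ 2 * C * s ^ 4 := by gcongr; exact one_le_pow₀ hs
  have g2 : ‖q‖ * ‖h‖ * 1 ≤ ‖q‖ * ‖h‖ * s ^ 3 := by gcongr; exact one_le_pow₀ hs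
  have g3 : ‖T‖ * ‖h‖ ^ 2 * 1 ≤ ‖T‖ * ‖h‖ ^ 2 * s ^ 2 := by gcongr; exact one_le_pow₀ hs
  have g4 : 0 ≤ ‖T‖ * ‖h‖ ^ 2 := by positivity
  norm_num
  linarith

end TestFunction

theorem gradient_testFun (x q : EuclideanSpace ℝ (Fin n))
    {T : EuclideanSpace ℝ (Fin n) →L[ℝ] EuclideanSpace ℝ (Fin n)}
    (hT : (T : EuclideanSpace ℝ (Fin n) →ₗ[ℝ] EuclideanSpace ℝ (Fin n)).IsSymmetric) (C : ℝ) :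
    gradient (testFun x q T C) x = q := by
  refine HasGradientAt.gradient ?_
  rw [hasGradientAt_iff_hasFDerivAt]
  refine (hasFDerivAt_testFun x q hT C x).congr_fderiv ?_
  ext h
  simp

theorem hessian_testFun (x q : EuclideanSpace ℝ (Fin n))
    {T : EuclideanSpace ℝ (Fin n) →L[ℝ] EuclideanSpace ℝ (Fin n)}
    (hT : (T : EuclideanSpace ℝ (Fin n) →ₗ[ℝ] EuclideanSpace ℝ (Fin n)).IsSymmetric) (C : ℝ) :
    hessian (testFun x q T C) x = formMatrix T := by
  ext i j
  simp only [hessian, formMatrix, fderiv_fderiv_testFun x q hT C, of_apply]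
  rfl

theorem formMatrix_isSymm {T : EuclideanSpace ℝ (Fin n) →L[ℝ] EuclideanSpace ℝ (Fin n)}
    (hT : (T : EuclideanSpace ℝ (Fin n) →ₗ[ℝ] EuclideanSpace ℝ (Fin n)).IsSymmetric) :
    (formMatrix T).IsSymm := by
  ext i j
  simp only [formMatrix, transpose_apply, of_apply]
  rw [real_inner_comm]
  exact (hT _ _).symm

theorem abs_formMatrix_add_smul_id_sub_le
    (T : EuclideanSpace ℝ (Fin n) →L[ℝ] EuclideanSpace ℝ (Fin n)) (c : ℝ) (i j : Fin n) :
    |formMatrix (T + c • ContinuousLinearMap.id ℝ _) i j - formMatrix T i j| ≤ |c| := by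
  simp only [formMatrix, of_apply, _root_.add_apply, _root_.smul_apply,
    ContinuousLinearMap.id_apply, inner_add_left, real_inner_smul_left, add_sub_cancel_left,
    abs_mul]
  have h := abs_real_inner_le_norm (EuclideanSpace.single i (1 : ℝ)) (EuclideanSpace.single j 1)
  simp only [PiLp.norm_single, norm_one, mul_one] at h
  nlinarith [abs_nonneg c]

theorem isSymmetric_add_smul_id {E : Type*} [NormedAddCommGroup E] [InnerProductSpace ℝ E]
    {T : E →L[ℝ] E} (hT : (T : E →ₗ[ℝ] E).IsSymmetric) (c : ℝ) :
    ((T + c • ContinuousLinearMap.id ℝ E : E →L[ℝ] E) : E →ₗ[ℝ] E).IsSymmetric := by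
  intro a b
  have := hT a b
  simp only [ContinuousLinearMap.coe_coe] at this
  simp only [ContinuousLinearMap.coe_coe, _root_.add_apply, _root_.smul_apply,
    ContinuousLinearMap.id_apply, inner_add_left, inner_add_right, real_inner_smul_left,
    real_inner_smul_right, this]

/-- Subsolutions satisfy the differential inequality, up to a small error, at upper second order
expansions. -/
theorem SubsolutionAt.exists_nonlin_lt (hn : 0 < n) {k : ℕ} {L : ℝ} (hL : 0 ≤ L)
    {K : Set (EuclideanSpace ℝ (Fin n))} {u : EuclideanSpace ℝ (Fin n) → ℝ}
    (husc : UpperSemicontinuousOn u K) {C : ℝ} (hC : ∀ y ∈ K, |u y| ≤ C)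
    {x q : EuclideanSpace ℝ (Fin n)} (hx : x ∈ K) (hu : SubsolutionAt k L K u x)
    {T : EuclideanSpace ℝ (Fin n) →L[ℝ] EuclideanSpace ℝ (Fin n)}
    (hT : (T : EuclideanSpace ℝ (Fin n) →ₗ[ℝ] EuclideanSpace ℝ (Fin n)).IsSymmetric)
    (hexp : ∀ τ > 0, ∀ᶠ h in 𝓝 (0 : EuclideanSpace ℝ (Fin n)), x + h ∈ K →
      u (x + h) ≤ u x + ⟪q, h⟫ + 1 / 2 * ⟪T h, h⟫ + τ * ‖h‖ ^ 2) {ρ : ℝ} (hρ : 0 < ρ) :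
    ∃ p X, ‖p - q‖ < ρ ∧ (∀ i j, |X i j - formMatrix T i j| < ρ) ∧ X.IsSymm ∧
      nonlin k L (p, X) < 1 + ρ := by
  -- The shift by `ρ / 2` absorbs the error `ρ / 4 * ‖h‖ ^ 2` and moves the Hessian entries by at
  -- most `ρ / 2`.
  have hT' := isSymmetric_add_smul_id hT (ρ / 2)
  obtain ⟨D, hD⟩ := exists_le_testFun hC hx q
    (T + (ρ / 2) • ContinuousLinearMap.id ℝ _) (by
      filter_upwards [hexp (ρ / 4) (by positivity)] with h hh hK
      have := hh hK
      simp only [_root_.add_apply, _root_.smul_apply, ContinuousLinearMap.id_apply,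
        inner_add_left, real_inner_smul_left, real_inner_self_eq_norm_sq]
      linarith)
  have h1 := hu _ (contDiff_testFun x q _ D) (fun y hy => by
    simp only [Set.mem_ofPred_eq, uscEnv_eq husc hC hy, uscEnv_eq husc hC hx]
    exact hD y hy)
  rw [gradient_testFun x q hT', hessian_testFun x q hT'] at h1
  obtain ⟨p, X, hp, hX, hs, hlt⟩ := exists_nonlin_lt_of_nonlinLower_lt hn hL
    (formMatrix_isSymm hT') (h1.trans_lt (by linarith : 1 < 1 + ρ)) (half_pos hρ)
  refine ⟨p, X, by linarith, fun i j => ?_, hs, hlt⟩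
  have g1 := hX i j
  have g2 := abs_formMatrix_add_smul_id_sub_le T (ρ / 2) i j
  rw [abs_of_pos (half_pos hρ)] at g2
  have g3 := abs_sub_le (X i j) (formMatrix (T + (ρ / 2) • ContinuousLinearMap.id ℝ _) i j)
    (formMatrix T i j)
  linarith

/-- Supersolutions satisfy the differential inequality, up to a small error, at lower second order
expansions. -/
theorem SupersolutionAt.exists_lt_nonlin (hn : 0 < n) {k : ℕ} {L : ℝ} (hL : 0 ≤ L)
    {K : Set (EuclideanSpace ℝ (Fin n))} {w : EuclideanSpace ℝ (Fin n) → ℝ}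
    (hlsc : LowerSemicontinuousOn w K) {C : ℝ} (hC : ∀ y ∈ K, |w y| ≤ C)
    {x q : EuclideanSpace ℝ (Fin n)} (hx : x ∈ K) (hw : SupersolutionAt k L K w x)
    {T : EuclideanSpace ℝ (Fin n) →L[ℝ] EuclideanSpace ℝ (Fin n)}
    (hT : (T : EuclideanSpace ℝ (Fin n) →ₗ[ℝ] EuclideanSpace ℝ (Fin n)).IsSymmetric)
    (hexp : ∀ τ > 0, ∀ᶠ h in 𝓝 (0 : EuclideanSpace ℝ (Fin n)), x + h ∈ K →
      -w (x + h) ≤ -w x + ⟪q, h⟫ + 1 / 2 * ⟪T h, h⟫ + τ * ‖h‖ ^ 2) {ρ : ℝ} (hρ : 0 < ρ) :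
    ∃ p X, ‖p + q‖ < ρ ∧ (∀ i j, |X i j + formMatrix T i j| < ρ) ∧ X.IsSymm ∧
      1 - ρ < nonlin k L (p, X) := by
  have hT' := isSymmetric_add_smul_id hT (ρ / 2)
  obtain ⟨D, hD⟩ := exists_le_testFun (v := fun y => -w y) (C := C)
    (fun y hy => by rw [abs_neg]; exact hC y hy) hx q
    (T + (ρ / 2) • ContinuousLinearMap.id ℝ _) (by
      filter_upwards [hexp (ρ / 4) (by positivity)] with h hh hK
      have := hh hK
      simp only [_root_.add_apply, _root_.smul_apply, ContinuousLinearMap.id_apply,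
        inner_add_left, real_inner_smul_left, real_inner_self_eq_norm_sq]
      linarith)
  set T' := T + (ρ / 2) • ContinuousLinearMap.id ℝ (EuclideanSpace ℝ (Fin n)) with hT'def
  have hneg : ((-T' : EuclideanSpace ℝ (Fin n) →L[ℝ] EuclideanSpace ℝ (Fin n)) :
      EuclideanSpace ℝ (Fin n) →ₗ[ℝ] EuclideanSpace ℝ (Fin n)).IsSymmetric := by
    intro a b
    have := hT' a b
    simp only [ContinuousLinearMap.coe_coe] at this
    simp only [ContinuousLinearMap.coe_coe, _root_.neg_apply, inner_neg_left, inner_neg_right, this]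
  -- The quartic lying above `-w` is negated, including its coefficient `D`, to touch `w` from
  -- below.
  have htest : ∀ y, testFun x (-q) (-T') (-D) y = -testFun x q T' D y := by
    intro y
    simp only [testFun, inner_neg_left, _root_.neg_apply]
    ring
  have hform : ∀ i j, formMatrix (-T') i j = -formMatrix T' i j := by
    intro i j
    simp only [formMatrix, of_apply, _root_.neg_apply, inner_neg_left]
  have h1 := hw _ (contDiff_testFun x (-q) (-T') (-D)) (fun y hy => by
    simp only [Set.mem_ofPred_eq, lscEnv_eq hlsc hC hy, lscEnv_eq hlsc hC hx, htest]
    have := hD y hy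
    linarith)
  rw [gradient_testFun x (-q) hneg, hessian_testFun x (-q) hneg] at h1
  obtain ⟨p, X, hp, hX, hs, hlt⟩ := exists_lt_nonlin_of_lt_nonlinUpper hn hL
    (formMatrix_isSymm hneg) ((by linarith : 1 - ρ < 1).trans_le h1) (half_pos hρ)
  refine ⟨p, X, by rw [sub_neg_eq_add] at hp; linarith, fun i j => ?_, hs, hlt⟩
  have g1 := hX i j
  rw [hform, sub_neg_eq_add] at g1
  have g2 := abs_formMatrix_add_smul_id_sub_le T (ρ / 2) i j
  rw [abs_of_pos (half_pos hρ), ← hT'def] at g2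
  rw [abs_lt] at *
  rw [abs_le] at g2
  constructor <;> linarith

end Envelopes

/-! ### Sup-convolutions -/

section SupConvolution

theorem upperSemicontinuousOn_const_mul {X : Type*} [TopologicalSpace X] {S : Set X} {f : X → ℝ}
    (hf : UpperSemicontinuousOn f S) {s : ℝ} (hs : 0 < s) :
    UpperSemicontinuousOn (fun x => s * f x) S := by
  intro x hx y hy
  have h1 : f x < y / s := by rwa [lt_div_iff₀ hs, mul_comm]
  filter_upwards [hf x hx _ h1] with z hz
  rwa [lt_div_iff₀ hs, mul_comm] at hz

theorem upperSemicontinuousOn_neg {X : Type*} [TopologicalSpace X] {S : Set X} {f : X → ℝ}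
    (hf : LowerSemicontinuousOn f S) : UpperSemicontinuousOn (fun x => -f x) S := by
  intro x hx y hy
  filter_upwards [hf x hx (-y) (by linarith)] with z hz
  linarith

variable {E : Type*} [NormedAddCommGroup E]

/-- `S` is the sup-convolution `ξ ↦ max_{x ∈ K} (A x - m ‖x - ξ‖² / 2)`, with the maximum attained
at `X ξ`. -/
structure IsSupConv (m : ℝ) (K : Set E) (A S : E → ℝ) (X : E → E) : Prop where
  mem : ∀ ξ, X ξ ∈ K
  eq : ∀ ξ, S ξ = A (X ξ) - m / 2 * ‖X ξ - ξ‖ ^ 2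
  le : ∀ ξ, ∀ x ∈ K, A x - m / 2 * ‖x - ξ‖ ^ 2 ≤ S ξ

theorem exists_isSupConv (m : ℝ) {K : Set E} (hK : IsCompact K) (hne : K.Nonempty) {A : E → ℝ}
    (hA : UpperSemicontinuousOn A K) : ∃ S X, IsSupConv m K A S X := by
  have hex : ∀ ξ, ∃ x ∈ K, ∀ y ∈ K, A y - m / 2 * ‖y - ξ‖ ^ 2 ≤ A x - m / 2 * ‖x - ξ‖ ^ 2 := by
    intro ξ
    have hc : Continuous fun x : E => -(m / 2 * ‖x - ξ‖ ^ 2) := by fun_prop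
    obtain ⟨x, hx, hmax⟩ := UpperSemicontinuousOn.exists_isMaxOn hne hK
      (hA.add (hc.upperSemicontinuous.upperSemicontinuousOn K))
    exact ⟨x, hx, fun y hy => by
      have := hmax hy
      simp only [Set.mem_ofPred_eq] at this
      linarith⟩
  choose X hX hmax using hex
  exact ⟨fun ξ => A (X ξ) - m / 2 * ‖X ξ - ξ‖ ^ 2, X, hX, fun _ => rfl, hmax⟩

namespace IsSupConv

variable {m R : ℝ} {K : Set E} {A S : E → ℝ} {X : E → E}

theorem belowParaboloids (h : IsSupConv m K A S X) (hR : ∀ x ∈ K, ‖x‖ ≤ R) :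
    BelowParaboloids m R S := by
  refine fun ξ => ⟨X ξ, hR _ (h.mem ξ), fun ζ => ?_⟩
  have := h.le ζ (X ξ) (h.mem ξ)
  rw [h.eq ξ]
  linarith

/-- Upper bounds for the sup-convolution at `ξ` translate into upper bounds for `A` at `X ξ`. -/
theorem le_of_le (h : IsSupConv m K A S X) {ξ d : E} {c : ℝ} (hc : S (ξ + d) ≤ S ξ + c)
    (hd : X ξ + d ∈ K) : A (X ξ + d) ≤ A (X ξ) + c := by
  -- The competitor `X ξ + d` is as far from `ξ + d` as `X ξ` is from `ξ`, so the penalties cancel.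
  have h1 := h.le (ξ + d) _ hd
  rw [add_sub_add_right_eq_sub] at h1
  rw [h.eq ξ] at hc
  linarith

theorem eventually_le [InnerProductSpace ℝ E] (h : IsSupConv m K A S X) {ξ q : E} {T : E →L[ℝ] E}
    (hS : HasQuadExpansion S ξ q T) {τ : ℝ} (hτ : 0 < τ) :
    ∀ᶠ d in 𝓝 (0 : E), X ξ + d ∈ K →
      A (X ξ + d) ≤ A (X ξ) + (⟪q, d⟫ + 1 / 2 * ⟪T d, d⟫ + τ * ‖d‖ ^ 2) := by
  filter_upwards [hS τ hτ] with d hd hK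
  refine h.le_of_le ?_ hK
  have := (abs_le.1 hd).2
  linarith

end IsSupConv

end SupConvolution

/-! ### Comparison -/

section Comparison

variable {n : ℕ}

theorem inner_eq_dotProduct_formMatrix
    (T : EuclideanSpace ℝ (Fin n) →L[ℝ] EuclideanSpace ℝ (Fin n)) (v : Fin n → ℝ) :
    ⟪T (WithLp.toLp 2 v), WithLp.toLp 2 v⟫ = v ⬝ᵥ formMatrix T *ᵥ v := by
  have hv : WithLp.toLp 2 v = ∑ i, v i • EuclideanSpace.single i (1 : ℝ) := by
    ext j
    simp [Pi.single_apply]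
  conv_lhs => rw [hv]
  simp only [map_sum, map_smul, sum_inner, inner_sum, real_inner_smul_left, real_inner_smul_right,
    dotProduct, mulVec, formMatrix, of_apply, Finset.mul_sum]
  rw [Finset.sum_comm]
  exact Finset.sum_congr rfl fun i _ => Finset.sum_congr rfl fun j _ => by ring

theorem abs_dotProduct_mulVec_le {M : Matrix (Fin n) (Fin n) ℝ} {r : ℝ}
    (hM : ∀ i j, |M i j| ≤ r) (v : Fin n → ℝ) :
    |v ⬝ᵥ M *ᵥ v| ≤ r * (n * (v ⬝ᵥ v)) := by
  have h1 : (∑ i, |v i|) ^ 2 ≤ n * (v ⬝ᵥ v) := by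
    have := sq_sum_le_card_mul_sum_sq (s := Finset.univ) (f := fun i => |v i|)
    simpa [dotProduct, sq] using this
  rcases isEmpty_or_nonempty (Fin n) with hempty | ⟨⟨i₀⟩⟩
  · simp [dotProduct]
  have hr : 0 ≤ r := (abs_nonneg _).trans (hM i₀ i₀)
  calc |v ⬝ᵥ M *ᵥ v| = |∑ i, ∑ j, v i * (M i j * v j)| := by
        simp [dotProduct, mulVec, Finset.mul_sum]
    _ ≤ ∑ i, ∑ j, |v i * (M i j * v j)| :=
        (Finset.abs_sum_le_sum_abs _ _).trans
          (Finset.sum_le_sum fun i _ => Finset.abs_sum_le_sum_abs _ _)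
    _ ≤ ∑ i, ∑ j, r * (|v i| * |v j|) :=
        Finset.sum_le_sum fun i _ => Finset.sum_le_sum fun j _ => by
          rw [abs_mul, abs_mul]
          nlinarith [mul_le_mul_of_nonneg_right (hM i j)
            (mul_nonneg (abs_nonneg (v i)) (abs_nonneg (v j)))]
    _ = r * (∑ i, |v i|) ^ 2 := by
        rw [sq, Finset.sum_mul_sum]
        simp only [Finset.mul_sum]
    _ ≤ r * (n * (v ⬝ᵥ v)) := mul_le_mul_of_nonneg_left h1 hr

theorem posSemidef_add_smul_one_of_near {M : Matrix (Fin n) (Fin n) ℝ} (hM : M.IsSymm)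
    {T : EuclideanSpace ℝ (Fin n) →L[ℝ] EuclideanSpace ℝ (Fin n)} {r c ρ : ℝ}
    (hr : ∀ i j, |M i j - formMatrix T i j| ≤ r) (hT : ∀ h, -(c * ‖h‖ ^ 2) ≤ ⟪T h, h⟫)
    (hρ : r * n + c ≤ ρ) : (M + ρ • (1 : Matrix (Fin n) (Fin n) ℝ)).PosSemidef := by
  refine PosSemidef.of_dotProduct_mulVec_nonneg ?_ fun v => ?_
  · rw [IsHermitian, conjTranspose_eq_transpose_of_trivial, transpose_add, hM.eq, transpose_smul,
      transpose_one]
  · have h1 := abs_dotProduct_mulVec_le (M := M - formMatrix T) (r := r) hr v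
    have h2 := hT (WithLp.toLp 2 v)
    rw [inner_eq_dotProduct_formMatrix, ← dotProduct_self_eq_norm_sq] at h2
    rw [sub_mulVec, dotProduct_sub] at h1
    have h3 := (abs_le.1 h1).1
    have h4 : 0 ≤ v ⬝ᵥ v := by
      simpa using dotProduct_star_self_nonneg v
    have h5 : (r * n + c) * (v ⬝ᵥ v) ≤ ρ * (v ⬝ᵥ v) := mul_le_mul_of_nonneg_right hρ h4
    rw [star_trivial, add_mulVec, dotProduct_add, smul_mulVec, one_mulVec, dotProduct_smul,
      smul_eq_mul]
    simp only at h2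
    linarith

/-- Polarization: `4 * ⟪T a, b⟫` is the difference of the form at `a + b` and `a - b`, whose squared
norms add up to 4. -/
theorem abs_formMatrix_le {T : EuclideanSpace ℝ (Fin n) →L[ℝ] EuclideanSpace ℝ (Fin n)}
    (hs : (T : EuclideanSpace ℝ (Fin n) →ₗ[ℝ] EuclideanSpace ℝ (Fin n)).IsSymmetric) {c : ℝ}
    (hT : ∀ h, |⟪T h, h⟫| ≤ c * ‖h‖ ^ 2) (i j : Fin n) : |formMatrix T i j| ≤ c := by
  set a := EuclideanSpace.single i (1 : ℝ) with ha
  set b := EuclideanSpace.single j (1 : ℝ) with hb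
  have ha1 : ‖a‖ = 1 := by simp [ha, PiLp.norm_single]
  have hb1 : ‖b‖ = 1 := by simp [hb, PiLp.norm_single]
  have hab : ⟪T b, a⟫ = ⟪T a, b⟫ := by
    rw [real_inner_comm]
    exact (hs a b).symm
  have h1 := abs_le.1 (hT (a + b))
  have h2 := abs_le.1 (hT (a - b))
  rw [norm_add_sq_real, ha1, hb1, map_add, inner_add_left, inner_add_right, inner_add_right,
    hab] at h1
  rw [norm_sub_sq_real, ha1, hb1, map_sub, inner_sub_left, inner_sub_right, inner_sub_right,
    hab] at h2
  rw [formMatrix, of_apply, ← ha, ← hb, abs_le]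
  constructor <;> linarith [h1.1, h1.2, h2.1, h2.2]

/-- A supersolution cannot be touched from below by a function with vanishing gradient and
Hessian. -/
theorem SupersolutionAt.not_flat (hn : 0 < n) {k : ℕ} {L : ℝ} (hL : 0 ≤ L)
    {K : Set (EuclideanSpace ℝ (Fin n))} {w : EuclideanSpace ℝ (Fin n) → ℝ}
    (hlsc : LowerSemicontinuousOn w K) {C : ℝ} (hC : ∀ y ∈ K, |w y| ≤ C)
    {x : EuclideanSpace ℝ (Fin n)} (hx : x ∈ K) (hw : SupersolutionAt k L K w x) {m : ℝ}
    (hflat : ∀ h, x + h ∈ K → -w (x + h) ≤ -w x + m * (‖h‖ ^ 2) ^ 2) : False := by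
  set ρ := 1 / (n ^ 3 * L + 2) with hρ
  have hρ0 : 0 < ρ := by positivity
  -- Since `(n ^ 3 * L + 2) * ρ = 1`, the bound `|F| ≤ n ^ 3 * L * ρ = 1 - 2 * ρ` contradicts `F > 1
  -- - ρ`.
  obtain ⟨p, X, -, hX, -, hlt⟩ := hw.exists_lt_nonlin hn hL hlsc hC hx (q := 0) (T := 0)
    (fun a b => by simp) (fun τ hτ => by
      have hc : Continuous fun h : EuclideanSpace ℝ (Fin n) => m * ‖h‖ ^ 2 := by fun_prop
      filter_upwards [(hc.tendsto 0).eventually_lt_const (by simpa using hτ)] with h hh hK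
      have h1 := hflat h hK
      simp only [inner_zero_left, _root_.zero_apply]
      nlinarith [sq_nonneg ‖h‖]) hρ0
  have h1 := abs_nonlin_le (k := k) (p := p) hn hL (M := X) (B := ρ) (fun i j => by
    simpa [formMatrix] using (hX i j).le)
  have h2 := (abs_le.1 h1).2
  have h3 : (n ^ 3 * L + 2) * ρ = 1 := by rw [hρ]; field_simp
  linarith

theorem quartic_le {E : Type*} [NormedAddCommGroup E] [InnerProductSpace ℝ E] {m : ℝ} (hm : 0 ≤ m)
    (z h : E) (hh : ‖h‖ ≤ 1) :
    m * (‖z + h‖ ^ 2) ^ 2 ≤ m * (‖z‖ ^ 2) ^ 2 + ⟪(4 * m * ‖z‖ ^ 2) • z, h⟫ +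
      m * (6 * ‖z‖ ^ 2 + 4 * ‖z‖ + 1) * ‖h‖ ^ 2 := by
  rw [norm_add_sq_real, real_inner_smul_left]
  have h1 := abs_le.1 (abs_real_inner_le_norm z h)
  set a := ‖z‖
  set c := ‖h‖
  set b := ⟪z, h⟫
  have ha : 0 ≤ a := norm_nonneg _
  have hc : 0 ≤ c := norm_nonneg _
  have g1 : b ^ 2 ≤ a ^ 2 * c ^ 2 := by nlinarith
  have g2 : b * c ^ 2 ≤ a * c ^ 2 := by
    refine mul_le_mul_of_nonneg_right ?_ (sq_nonneg c)
    nlinarith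
  have g3 : c ^ 2 * c ^ 2 ≤ 1 * c ^ 2 := by
    refine mul_le_mul_of_nonneg_right ?_ (sq_nonneg c)
    nlinarith
  have g4 : (a ^ 2 + 2 * b + c ^ 2) ^ 2 ≤
      (a ^ 2) ^ 2 + 4 * a ^ 2 * b + (6 * a ^ 2 + 4 * a + 1) * c ^ 2 := by nlinarith
  nlinarith [mul_le_mul_of_nonneg_left g4 hm]

/-- The differential inequalities at ordered second order expansions are incompatible. -/
theorem false_of_expansions (hn : 0 < n) {k : ℕ} {L : ℝ} (hL : 0 ≤ L)
    {K K' : Set (EuclideanSpace ℝ (Fin n))} {u w : EuclideanSpace ℝ (Fin n) → ℝ}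
    (husc : UpperSemicontinuousOn u K) (hlsc : LowerSemicontinuousOn w K') {C : ℝ}
    (hCu : ∀ y ∈ K, |u y| ≤ C) (hCw : ∀ y ∈ K', |w y| ≤ C) {s : ℝ} (hs0 : 0 < s) (hs1 : s < 1)
    {m R : ℝ} (hm : 0 < m) {S₁ S₂ : EuclideanSpace ℝ (Fin n) → ℝ}
    {X₁ X₂ : EuclideanSpace ℝ (Fin n) → EuclideanSpace ℝ (Fin n)}
    (h₁ : IsSupConv m K (fun x => s * u x) S₁ X₁) (h₂ : IsSupConv m K' (fun x => -w x) S₂ X₂)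
    (hR : ∀ x ∈ K, ‖x‖ ≤ R) (hR' : ∀ x ∈ K', ‖x‖ ≤ R) {φ : EuclideanSpace ℝ (Fin n) → ℝ}
    {η₀ z p : EuclideanSpace ℝ (Fin n)} (hp : p ≠ 0) {D : ℝ} (hD : 0 ≤ D)
    (hmax : ∀ ξ η, S₁ ξ + S₂ η - φ (ξ - η) ≤ S₁ (η₀ + z) + S₂ η₀ - φ z)
    (hφ : ∀ h, ‖h‖ ≤ 1 → φ (z + h) ≤ φ z + ⟪p, h⟫ + D * ‖h‖ ^ 2) {ε : ℝ} (hε : 0 < ε)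
    (hgood : ∀ η, S₁ (η₀ + z) + S₂ η₀ - ε ≤ S₁ (η + z) + S₂ η →
      SubsolutionAt k L K u (X₁ (η + z)) ∧ SupersolutionAt k L K' w (X₂ η)) : False := by
  -- The bound `m + 2` comes from entries of `T₁` at most `m + 1` plus an error `σ ≤ 1`.
  obtain ⟨ρ, hρ, hcmp⟩ := exists_nonlin_le_add hn (k := k) hL hp (B := m + 2)
    (τ := (1 - s) / 3) (by positivity) (by linarith)
  have hn' : (1 : ℝ) ≤ n := by exact_mod_cast hn
  set σ := min (min (ρ / (4 * n)) ((1 - s) / 6)) 1 with hσ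
  have hσ0 : 0 < σ := by
    have : 0 < 1 - s := by linarith
    positivity
  have hσ1 : σ ≤ ρ / (4 * n) := (min_le_left _ _).trans (min_le_left _ _)
  have hσ2 : σ ≤ (1 - s) / 6 := (min_le_left _ _).trans (min_le_right _ _)
  have hσ3 : σ ≤ 1 := min_le_right _ _
  have hσn : σ * n ≤ ρ / 4 := by
    calc σ * n ≤ ρ / (4 * n) * n := by gcongr
      _ = ρ / 4 := by field_simp
  have hσρ : σ ≤ ρ / 4 := by nlinarith
  set δ := min (1 / 2) (ρ / 4) with hδ
  have hδ0 : 0 < δ := by positivity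
  obtain ⟨η, q₁, q₂, T₁, T₂, hval, hq₁, hq₂, hs₁, hs₂, he₁, he₂, hl₁, hl₂, hle⟩ :=
    exists_hasQuadExpansion_pair hm (h₁.belowParaboloids hR) (h₂.belowParaboloids hR') hD hmax hφ
      (ε := min ε (ρ / 4)) (δ := δ) (by positivity) hδ0
  obtain ⟨hsub, hsuper⟩ := hgood η (by linarith [min_le_left ε (ρ / 4)])
  have hq₁' : ‖q₁ - p‖ ≤ ρ / 4 := hq₁.trans (min_le_right _ _)
  have hq₂' : ‖q₂ + p‖ ≤ ρ / 4 := hq₂.trans (min_le_right _ _)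
  -- The sup-convolution is of `s * u`, so the expansion for `u` itself carries the factor `s⁻¹`.
  obtain ⟨p', X, hp', hX, hXs, hXlt⟩ := hsub.exists_nonlin_lt hn hL husc hCu (h₁.mem _)
    (q := s⁻¹ • q₁) (T := s⁻¹ • T₁) (fun a b => by
      have := hs₁ a b
      simp only [ContinuousLinearMap.coe_coe] at this
      simp only [ContinuousLinearMap.coe_coe, _root_.smul_apply, real_inner_smul_left,
        real_inner_smul_right, this]) (fun τ hτ => by
      filter_upwards [h₁.eventually_le he₁ (mul_pos hs0 hτ)] with h hh hK
      have i1 := mul_le_mul_of_nonneg_left (hh hK) (inv_pos.2 hs0).le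
      simp only [_root_.smul_apply, real_inner_smul_left]
      have i2 : s⁻¹ * (s * u (X₁ (η + z) + h)) = u (X₁ (η + z) + h) := by field_simp
      have i3 : s⁻¹ * (s * u (X₁ (η + z)) + (⟪q₁, h⟫ + 1 / 2 * ⟪T₁ h, h⟫ + s * τ * ‖h‖ ^ 2)) =
          u (X₁ (η + z)) + s⁻¹ * ⟪q₁, h⟫ + 1 / 2 * (s⁻¹ * ⟪T₁ h, h⟫) + τ * ‖h‖ ^ 2 := by
        field_simp
        ring
      rw [i2, i3] at i1
      exact i1) hσ0
  obtain ⟨q', Y, hq', hY, hYs, hYlt⟩ := hsuper.exists_lt_nonlin hn hL hlsc hCw (h₂.mem _)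
    (q := q₂) (T := T₂) hs₂ (fun τ hτ => by
      filter_upwards [h₂.eventually_le he₂ hτ] with h hh hK
      have := hh hK
      linarith) hσ0
  have hX' : ∀ i j, |(s • X) i j - formMatrix T₁ i j| ≤ σ := by
    intro i j
    have j1 : (s • X) i j - formMatrix T₁ i j = s * (X i j - formMatrix (s⁻¹ • T₁) i j) := by
      simp only [formMatrix, of_apply, Matrix.smul_apply, _root_.smul_apply, real_inner_smul_left,
        smul_eq_mul]
      field_simp
    rw [j1, abs_mul, abs_of_pos hs0]
    nlinarith [hX i j, abs_nonneg (X i j - formMatrix (s⁻¹ • T₁) i j)]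
  have hp'' : ‖s • p' - p‖ < ρ := by
    have j1 : s • p' - p = s • (p' - s⁻¹ • q₁) + (q₁ - p) := by
      rw [smul_sub, smul_smul, mul_inv_cancel₀ hs0.ne', one_smul]; abel
    have j2 : ‖s • (p' - s⁻¹ • q₁)‖ ≤ σ := by
      rw [norm_smul, Real.norm_of_nonneg hs0.le]
      nlinarith [norm_nonneg (p' - s⁻¹ • q₁)]
    rw [j1]
    exact (norm_add_le _ _).trans_lt (by linarith)
  have hq'' : ‖q' - p‖ < ρ := by
    rw [show q' - p = (q' + q₂) - (q₂ + p) by abel]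
    exact (norm_sub_le _ _).trans_lt (by linarith)
  -- Semiconvexity bounds `T₁` below by `-m`; the bound on `T₁ + T₂` with that of `T₂` gives the
  -- upper bound.
  have hent : ∀ i j, |formMatrix T₁ i j| ≤ m + 1 := by
    refine abs_formMatrix_le hs₁ fun h => ?_
    rw [abs_le]
    have i1 := hl₁ h
    have i2 := hl₂ h
    have i3 := hle h
    have i4 : 2 * δ * ‖h‖ ^ 2 ≤ 1 * ‖h‖ ^ 2 := by
      refine mul_le_mul_of_nonneg_right ?_ (sq_nonneg _)
      linarith [min_le_left (1 / 2 : ℝ) (ρ / 4)]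
    have i5 := sq_nonneg ‖h‖
    constructor <;> linarith
  have hfinal := hcmp (s • p') q' (s • X) Y hp'' hq'' (fun i j => by
      have i1 := hX' i j
      have i2 := hent i j
      have i3 := abs_sub_abs_le_abs_sub ((s • X) i j) (formMatrix T₁ i j)
      linarith)
    (posSemidef_add_smul_one_of_near (T := -T₂ - T₁) (r := 2 * σ) (c := 2 * δ)
      (hYs.sub (hXs.smul s)) (fun i j => by
        have i1 := (hY i j).le
        have i2 := hX' i j
        have i3 : (Y - s • X) i j - formMatrix (-T₂ - T₁) i j =
            (Y i j + formMatrix T₂ i j) - ((s • X) i j - formMatrix T₁ i j) := by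
          simp only [formMatrix, of_apply, Matrix.sub_apply, _root_.sub_apply, _root_.neg_apply,
            inner_sub_left, inner_neg_left]
          ring
        rw [i3]
        exact (abs_sub _ _).trans (by linarith)) (fun h => by
        have := hle h
        simp only [_root_.sub_apply, _root_.neg_apply, inner_sub_left, inner_neg_left]
        linarith) (by linarith [min_le_right (1 / 2 : ℝ) (ρ / 4)]))
  -- Now `1 - σ < s * (1 + σ) + (1 - s) / 3`, which is false for `σ ≤ (1 - s) / 6`.
  rw [nonlin_smul k L hs0] at hfinal
  have i1 : s * nonlin k L (p', X) < s * (1 + σ) := mul_lt_mul_of_pos_left hXlt hs0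
  have i2 : s * σ ≤ σ := by nlinarith
  linarith

/-- The doubling of variables argument: sub- and supersolution inequalities at all pairs of nearby
points where `s u x - w y` is almost as large as `s u x₀ - w x₀` are contradictory. -/
theorem false_of_forall_near_max (hn : 0 < n) {k : ℕ} {L : ℝ} (hL : 0 ≤ L)
    {K K' : Set (EuclideanSpace ℝ (Fin n))} (hK : IsCompact K) (hK' : IsCompact K')
    (hKK' : K ⊆ K') {u w : EuclideanSpace ℝ (Fin n) → ℝ}
    (husc : UpperSemicontinuousOn u K) (hlsc : LowerSemicontinuousOn w K') {C : ℝ}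
    (hCu : ∀ y ∈ K, |u y| ≤ C) (hCw : ∀ y ∈ K', |w y| ≤ C) {s : ℝ} (hs0 : 0 < s) (hs1 : s < 1)
    {x₀ : EuclideanSpace ℝ (Fin n)} (hx₀ : x₀ ∈ K) {τ : ℝ} (hτ : 0 < τ)
    (hgood : ∀ x ∈ K, ∀ y ∈ K', ‖x - y‖ < τ → s * u x₀ - w x₀ - τ ≤ s * u x - w y →
      SubsolutionAt k L K u x ∧ SupersolutionAt k L K' w y) : False := by
  have hC0 : 0 ≤ C := (abs_nonneg _).trans (hCu x₀ hx₀)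
  have hsu : ∀ x ∈ K, |s * u x| ≤ C := by
    intro x hx
    rw [abs_mul, abs_of_pos hs0]
    nlinarith [hCu x hx, abs_nonneg (u x)]
  set t := τ / 3 with ht
  have ht0 : 0 < t := by positivity
  -- Where the penalised sum is at least `-(2 * C) - 1`, each penalty is at most `4 * C + 1`; this
  -- `m` then forces all three distances below `t = τ / 3`.
  set m := (4 * C + 2) * (2 / t ^ 2 + 1 / (t ^ 2) ^ 2) with hm
  have hm0 : 0 < m := by positivity
  have hm1 : 4 * C + 2 ≤ m / 2 * t ^ 2 := by
    have : m / 2 * t ^ 2 = (4 * C + 2) * (1 + 1 / (2 * t ^ 2)) := by rw [hm]; field_simp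
    rw [this]
    have : 0 ≤ 1 / (2 * t ^ 2) := by positivity
    nlinarith
  have hm2 : 4 * C + 2 ≤ m * (t ^ 2) ^ 2 := by
    have : m * (t ^ 2) ^ 2 = (4 * C + 2) * (2 * t ^ 2 + 1) := by rw [hm]; field_simp
    rw [this]
    have : 0 ≤ 2 * t ^ 2 := by positivity
    nlinarith
  obtain ⟨S₁, X₁, h₁⟩ := exists_isSupConv m hK ⟨x₀, hx₀⟩
    (upperSemicontinuousOn_const_mul husc hs0)
  obtain ⟨S₂, X₂, h₂⟩ := exists_isSupConv m hK' ⟨x₀, hKK' hx₀⟩ (upperSemicontinuousOn_neg hlsc)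
  obtain ⟨R, hR'⟩ := hK'.isBounded.exists_norm_le
  have hR : ∀ x ∈ K, ‖x‖ ≤ R := fun x hx => hR' x (hKK' hx)
  have lt_of : ∀ a : ℝ, m / 2 * a ^ 2 < m / 2 * t ^ 2 → a < t := fun a ha =>
    lt_of_pow_lt_pow_left₀ 2 ht0.le (lt_of_mul_lt_mul_left ha (by positivity))
  have near : ∀ ξ η, -(2 * C) - 1 ≤ S₁ ξ + S₂ η - m * (‖ξ - η‖ ^ 2) ^ 2 →
      ‖X₁ ξ - ξ‖ < t ∧ ‖X₂ η - η‖ < t ∧ ‖ξ - η‖ < t := by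
    intro ξ η h
    rw [h₁.eq, h₂.eq] at h
    have i1 := (abs_le.1 (hsu _ (h₁.mem ξ))).2
    have i2 := (abs_le.1 (hCw _ (h₂.mem η))).1
    have i3 : 0 ≤ m / 2 * ‖X₁ ξ - ξ‖ ^ 2 := by positivity
    have i4 : 0 ≤ m / 2 * ‖X₂ η - η‖ ^ 2 := by positivity
    have i5 : 0 ≤ m * (‖ξ - η‖ ^ 2) ^ 2 := by positivity
    refine ⟨lt_of _ (by linarith), lt_of _ (by linarith), ?_⟩
    have i6 : m * (‖ξ - η‖ ^ 2) ^ 2 < m * (t ^ 2) ^ 2 := by linarith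
    have i7 := lt_of_pow_lt_pow_left₀ 2 (by positivity) (lt_of_mul_lt_mul_left i6 hm0.le)
    exact lt_of_pow_lt_pow_left₀ 2 ht0.le i7
  have hval : ∀ ξ η, S₁ ξ + S₂ η - m * (‖ξ - η‖ ^ 2) ^ 2 ≤ s * u (X₁ ξ) - w (X₂ η) := by
    intro ξ η
    rw [h₁.eq, h₂.eq]
    have i3 : 0 ≤ m / 2 * ‖X₁ ξ - ξ‖ ^ 2 := by positivity
    have i4 : 0 ≤ m / 2 * ‖X₂ η - η‖ ^ 2 := by positivity
    have i5 : 0 ≤ m * (‖ξ - η‖ ^ 2) ^ 2 := by positivity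
    linarith
  have hbase : s * u x₀ - w x₀ ≤ S₁ x₀ + S₂ x₀ := by
    have i1 := h₁.le x₀ x₀ hx₀
    have i2 := h₂.le x₀ x₀ (hKK' hx₀)
    rw [sub_self, norm_zero] at i1 i2
    linarith
  have hlow : -(2 * C) ≤ s * u x₀ - w x₀ := by
    have i1 := (abs_le.1 (hsu _ hx₀)).1
    have i2 := (abs_le.1 (hCw _ (hKK' hx₀))).2
    linarith
  have hgood' : ∀ ξ η, s * u x₀ - w x₀ - min τ 1 ≤ S₁ ξ + S₂ η - m * (‖ξ - η‖ ^ 2) ^ 2 →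
      SubsolutionAt k L K u (X₁ ξ) ∧ SupersolutionAt k L K' w (X₂ η) := by
    intro ξ η h
    obtain ⟨n1, n2, n3⟩ := near ξ η (by linarith [min_le_right τ 1])
    refine hgood _ (h₁.mem ξ) _ (h₂.mem η) ?_ (by linarith [hval ξ η, min_le_left τ 1])
    rw [show X₁ ξ - X₂ η = (X₁ ξ - ξ) + (ξ - η) - (X₂ η - η) by abel]
    have i1 := norm_sub_le ((X₁ ξ - ξ) + (ξ - η)) (X₂ η - η)
    have i2 := norm_add_le (X₁ ξ - ξ) (ξ - η)
    linarith
  have c₁ := (h₁.belowParaboloids hR).continuous hm0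
  have c₂ := (h₂.belowParaboloids hR').continuous hm0
  have hcont : Continuous fun r : EuclideanSpace ℝ (Fin n) × EuclideanSpace ℝ (Fin n) =>
      S₁ r.1 + S₂ r.2 - m * (‖r.1 - r.2‖ ^ 2) ^ 2 := by fun_prop
  have hbd : Bornology.IsBounded {r : EuclideanSpace ℝ (Fin n) × EuclideanSpace ℝ (Fin n) |
      S₁ x₀ + S₂ x₀ - m * (‖x₀ - x₀‖ ^ 2) ^ 2 ≤ S₁ r.1 + S₂ r.2 - m * (‖r.1 - r.2‖ ^ 2) ^ 2} := by
    refine (Metric.isBounded_closedBall (x := 0) (r := R + t)).subset fun r hr => ?_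
    have hr' : S₁ x₀ + S₂ x₀ - m * (‖x₀ - x₀‖ ^ 2) ^ 2 ≤
      S₁ r.1 + S₂ r.2 - m * (‖r.1 - r.2‖ ^ 2) ^ 2 := hr
    rw [sub_self, norm_zero] at hr'
    obtain ⟨n1, n2, -⟩ := near r.1 r.2 (by linarith)
    rw [mem_closedBall_zero_iff, Prod.norm_def, max_le_iff]
    have e1 := hR _ (h₁.mem r.1)
    have e2 := hR' _ (h₂.mem r.2)
    have e3 := norm_le_norm_add_norm_sub (X₁ r.1) r.1
    have e4 := norm_le_norm_add_norm_sub (X₂ r.2) r.2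
    constructor <;> linarith
  obtain ⟨⟨ξ₀, η₀⟩, hmax⟩ := hcont.exists_forall_ge_of_isBounded (x₀, x₀) hbd
  obtain ⟨z, rfl⟩ : ∃ z, ξ₀ = η₀ + z := ⟨ξ₀ - η₀, by abel⟩
  have hmax' : ∀ ξ η, S₁ ξ + S₂ η - m * (‖ξ - η‖ ^ 2) ^ 2 ≤
      S₁ (η₀ + z) + S₂ η₀ - m * (‖z‖ ^ 2) ^ 2 := by
    intro ξ η
    have := hmax (ξ, η)
    simpa only [add_sub_cancel_left] using this
  have hM := hmax' x₀ x₀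
  rw [sub_self, norm_zero] at hM
  -- If `z = 0`, moving only `η` bounds `S₂` by its maximum value plus `m * ‖h‖ ^ 4`, and this
  -- passes to `-w`.
  rcases eq_or_ne z 0 with rfl | hz
  · obtain ⟨-, hsuper⟩ := hgood' (η₀ + 0) η₀ (by
      rw [add_sub_cancel_left]
      have : 0 < min τ 1 := by positivity
      linarith)
    refine hsuper.not_flat hn hL hlsc hCw (h₂.mem η₀) (m := m) fun h hh => ?_
    refine h₂.le_of_le ?_ hh
    have i1 := hmax' (η₀ + 0) (η₀ + h)
    rw [show η₀ + 0 - (η₀ + h) = -h by abel, norm_neg, norm_zero] at i1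
    linarith
  · have hz0 : 0 < ‖z‖ := norm_pos_iff.2 hz
    refine false_of_expansions (k := k) hn hL husc hlsc hCu hCw hs0 hs1 hm0 h₁ h₂ hR hR'
      (φ := fun z => m * (‖z‖ ^ 2) ^ 2) (p := (4 * m * ‖z‖ ^ 2) • z)
      (D := m * (6 * ‖z‖ ^ 2 + 4 * ‖z‖ + 1))
      (smul_ne_zero (by positivity) hz) (by positivity) hmax' (quartic_le hm0.le z)
      (ε := min τ 1) (by positivity) fun η hη => hgood' (η + z) η ?_
    rw [add_sub_cancel_left]
    linarith

end Comparison

/-! ### Boundary maximum and comparison under zero boundary conditions -/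

section MaximumPrinciple

variable {n : ℕ}

theorem frontier_nonempty_of_isCompact (hn : 0 < n) {K : Set (EuclideanSpace ℝ (Fin n))}
    (hK : IsCompact K) (hne : K.Nonempty) : (frontier K).Nonempty := by
  have : Nonempty (Fin n) := ⟨⟨0, hn⟩⟩
  by_contra h
  rw [Set.not_nonempty_iff_eq_empty, ← isClopen_iff_frontier_eq_empty] at h
  have huniv := h.eq_univ hne
  rw [huniv] at hK
  exact noncompact_univ _ hK

/-- If `f - g ≤ M` on a compact set, then `f x - g y < M + γ` at all pairs of points near it. -/
theorem exists_forall_near_lt {K Z : Set (EuclideanSpace ℝ (Fin n))} (hZ : IsCompact Z)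
    (hZK : Z ⊆ K) {f g : EuclideanSpace ℝ (Fin n) → ℝ} (hf : UpperSemicontinuousOn f K)
    (hg : LowerSemicontinuousOn g K) {M γ : ℝ} (hγ : 0 < γ) (hM : ∀ z ∈ Z, f z - g z ≤ M) :
    ∃ δ > 0, ∀ z ∈ Z, ∀ x ∈ K, ∀ y ∈ K, x ∈ Metric.ball z δ → y ∈ Metric.ball z δ →
      f x - g y < M + γ := by
  have hloc : ∀ c : Z, ∃ r > 0, ∀ x ∈ K, x ∈ Metric.ball (c : EuclideanSpace ℝ (Fin n)) r →
      f x < f c + γ / 2 ∧ g c - γ / 2 < g x := by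
    intro c
    have h1 := (hf c (hZK c.2) (f c + γ / 2) (by linarith)).and
      (hg c (hZK c.2) (g c - γ / 2) (by linarith))
    obtain ⟨r, hr, hb⟩ := Metric.eventually_nhds_iff.1 (eventually_nhdsWithin_iff.1 h1)
    exact ⟨r, hr, fun x hx hxr => hb hxr hx⟩
  choose r hr hb using hloc
  -- A Lebesgue number puts `x` and `y` in one ball about some `c ∈ Z`, where semicontinuity
  -- compares with `f c - g c ≤ M`.
  obtain ⟨δ, hδ, hcov⟩ := lebesgue_number_lemma_of_metric hZ
    (c := fun c : Z => Metric.ball (c : EuclideanSpace ℝ (Fin n)) (r c))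
    (fun _ => Metric.isOpen_ball)
    (fun z hz => Set.mem_iUnion.2 ⟨⟨z, hz⟩, Metric.mem_ball_self (hr _)⟩)
  refine ⟨δ, hδ, fun z hz x hx y hy hxz hyz => ?_⟩
  obtain ⟨c, hc⟩ := hcov z hz
  have h1 := (hb c x hx (hc hxz)).1
  have h2 := (hb c y hy (hc hyz)).2
  have h3 := hM c c.2
  linarith

/-- The difference of a subsolution and a supersolution attains its maximum on the boundary. -/
theorem exists_isMaxOn_frontier (hn : 0 < n) {k : ℕ} {L : ℝ} (hL : 0 ≤ L)
    {K : Set (EuclideanSpace ℝ (Fin n))} (hK : IsCompact K) (hne : K.Nonempty)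
    {u w : EuclideanSpace ℝ (Fin n) → ℝ} (husc : UpperSemicontinuousOn u K)
    (hu : IsViscositySubsolution k L K u) (hlsc : LowerSemicontinuousOn w K)
    (hw : IsViscositySupersolution k L K w) :
    ∃ x ∈ frontier K, IsMaxOn (fun y => u y - w y) K x := by
  obtain ⟨⟨C₁, hC₁⟩, hsub⟩ := hu
  obtain ⟨⟨C₂, hC₂⟩, hsuper⟩ := hw
  set C := max C₁ C₂ with hC
  have hCu : ∀ x ∈ K, |u x| ≤ C := fun x hx => (hC₁ x hx).trans (le_max_left _ _)
  have hCw : ∀ x ∈ K, |w x| ≤ C := fun x hx => (hC₂ x hx).trans (le_max_right _ _)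
  have hFK : frontier K ⊆ K := hK.isClosed.frontier_subset
  have hFc : IsCompact (frontier K) := hK.of_isClosed_subset isClosed_frontier hFK
  have hdiff : UpperSemicontinuousOn (fun x => u x + -w x) K :=
    husc.add (upperSemicontinuousOn_neg hlsc)
  obtain ⟨x₁, hx₁, hmax₁⟩ := hdiff.exists_isMaxOn hne hK
  obtain ⟨x₂, hx₂, hmax₂⟩ := UpperSemicontinuousOn.exists_isMaxOn
    (frontier_nonempty_of_isCompact hn hK hne) hFc (hdiff.mono hFK)
  refine ⟨x₂, hx₂, ?_⟩
  by_contra hnot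
  have hgap : u x₂ - w x₂ < u x₁ - w x₁ := by
    by_contra! hge
    refine hnot fun y hy => ?_
    have := hmax₁ hy
    simp only [Set.mem_ofPred_eq] at this ⊢
    linarith
  set g := (u x₁ - w x₁) - (u x₂ - w x₂) with hg
  have hg0 : 0 < g := by linarith
  have b1 := abs_le.1 (hCu x₁ hx₁)
  have b2 := abs_le.1 (hCw x₁ hx₁)
  have b3 := abs_le.1 (hCu x₂ (hFK hx₂))
  have b4 := abs_le.1 (hCw x₂ (hFK hx₂))
  have hC0 : 0 ≤ C := by linarith
  -- Then `(1 - s) * (C + 1) = g / 4`, so `s * u` is within `g / 4` of `u` on `K`.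
  set s := 1 - g / (4 * (C + 1)) with hs
  have hs1 : s < 1 := by
    have : 0 < g / (4 * (C + 1)) := by positivity
    linarith
  have hs0 : 0 < s := by
    have : g / (4 * (C + 1)) < 1 := by
      rw [div_lt_one (by positivity)]
      linarith [b1.2, b2.1, b3.1, b4.2]
    linarith
  have hsC : (1 - s) * C ≤ g / 4 := by
    calc (1 - s) * C ≤ (1 - s) * (C + 1) := by
          apply mul_le_mul_of_nonneg_left <;> linarith
      _ = g / 4 := by rw [hs]; field_simp; ring
  have hclose : ∀ x ∈ K, |s * u x - u x| ≤ g / 4 := by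
    intro x hx
    rw [show s * u x - u x = -((1 - s) * u x) by ring, abs_neg, abs_mul,
      abs_of_pos (by linarith : 0 < 1 - s)]
    refine le_trans ?_ hsC
    exact mul_le_mul_of_nonneg_left (hCu x hx) (by linarith)
  -- On the frontier the gap `g` loses `g / 4` twice, leaving `g / 2`; nearby pairs still miss the
  -- value at `x₁` by more than `g / 4`.
  obtain ⟨δ, hδ, hnear⟩ := exists_forall_near_lt hFc hFK
    (upperSemicontinuousOn_const_mul husc hs0) hlsc (M := s * u x₁ - w x₁ - g / 2) (γ := g / 4)
    (by positivity) (fun z hz => by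
      have c1 := abs_le.1 (hclose z (hFK hz))
      have c2 := abs_le.1 (hclose x₁ hx₁)
      have c3 := hmax₂ hz
      simp only [Set.mem_ofPred_eq] at c3
      linarith [c1.2, c2.1])
  refine false_of_forall_near_max (k := k) hn hL hK hK subset_rfl husc hlsc hCu hCw hs0 hs1 hx₁
    (τ := min δ (g / 4)) (by positivity) fun x hx y hy hxy hval => ?_
  have hdist : dist x y < δ := by
    rw [dist_eq_norm]; exact hxy.trans_le (min_le_left _ _)
  have hval' : s * u x₁ - w x₁ - g / 4 ≤ s * u x - w y := by
    linarith [min_le_right δ (g / 4)]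
  rw [hK.isClosed.frontier_eq] at hnear
  refine ⟨hsub x ?_, hsuper y ?_⟩
  · by_contra hxi
    have := hnear x ⟨hx, hxi⟩ x hx y hy (Metric.mem_ball_self hδ) (by
      rwa [Metric.mem_ball, dist_comm])
    linarith
  · by_contra hyi
    have := hnear y ⟨hy, hyi⟩ x hx y hy hdist (Metric.mem_ball_self hδ)
    linarith

/-- A supersolution with the zero boundary condition is nonnegative. -/
theorem nonneg_of_superZeroBoundary (hn : 0 < n) {k : ℕ} {L : ℝ} (hL : 0 ≤ L)
    {K : Set (EuclideanSpace ℝ (Fin n))} (hK : IsCompact K) {w : EuclideanSpace ℝ (Fin n) → ℝ}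
    (hlsc : LowerSemicontinuousOn w K) (hw : IsViscositySupersolution k L K w)
    (hbd : SuperZeroBoundary k L K w) : ∀ y ∈ K, 0 ≤ w y := by
  obtain ⟨⟨C, hC⟩, hsuper⟩ := hw
  intro y hy
  obtain ⟨y₀, hy₀, hmin⟩ := hlsc.exists_isMinOn ⟨y, hy⟩ hK
  by_contra! hlt
  have hy₀lt : w y₀ < 0 := (hmin hy).trans_lt hlt
  have hS : SupersolutionAt k L K w y₀ := by
    by_cases hi : y₀ ∈ interior K
    · exact hsuper y₀ hi
    · refine hbd y₀ ?_ (by rwa [lscEnv_eq hlsc hC hy₀])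
      rw [hK.isClosed.frontier_eq]
      exact ⟨hy₀, hi⟩
  -- At a negative minimum a constant touches `w` from below.
  refine hS.not_flat hn hL hlsc hC hy₀ (m := 0) fun h hh => ?_
  have := hmin hh
  simp only [Set.mem_ofPred_eq] at this
  linarith

/-- Comparison of sub- and supersolutions with the zero boundary condition. -/
theorem le_of_zeroBoundary (hn : 0 < n) {k : ℕ} {L : ℝ} (hL : 0 ≤ L)
    {K K' : Set (EuclideanSpace ℝ (Fin n))} (hK : IsCompact K) (hK' : IsCompact K')
    (hKK' : K ⊆ interior K') {u w : EuclideanSpace ℝ (Fin n) → ℝ}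
    (husc : UpperSemicontinuousOn u K) (hu : IsViscositySubsolution k L K u)
    (hub : SubZeroBoundary k L K u) (hlsc : LowerSemicontinuousOn w K')
    (hw : IsViscositySupersolution k L K' w) (hwb : SuperZeroBoundary k L K' w) :
    ∀ x ∈ K, u x ≤ w x := by
  have hw0 := nonneg_of_superZeroBoundary hn hL hK' hlsc hw hwb
  obtain ⟨⟨C₁, hC₁⟩, hsub⟩ := hu
  obtain ⟨⟨C₂, hC₂⟩, hsuper⟩ := hw
  have hsubset : K ⊆ K' := hKK'.trans interior_subset
  intro x₀ hx₀
  by_contra! hlt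
  have hwx := hw0 x₀ (hsubset hx₀)
  have hux : 0 < u x₀ := hwx.trans_lt hlt
  -- The midpoint of `w x₀ / u x₀` and 1, so that `s * u x₀ - w x₀` is half of `u x₀ - w x₀`, still
  -- positive.
  set s := (1 + w x₀ / u x₀) / 2 with hs
  have hs0 : 0 < s := by positivity
  have hs1 : s < 1 := by
    have : w x₀ / u x₀ < 1 := by rwa [div_lt_one hux]
    linarith
  have hM : s * u x₀ - w x₀ = (u x₀ - w x₀) / 2 := by rw [hs]; field_simp; ring
  -- The `δ`-neighbourhood of `K` lies in the interior of `K'`, so the boundary condition on `w`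
  -- enters only through `w ≥ 0`.
  obtain ⟨δ, hδ, hball⟩ := lebesgue_number_lemma_of_metric hK (c := fun _ : Unit => interior K')
    (fun _ => isOpen_interior) (fun x hx => Set.mem_iUnion.2 ⟨(), hKK' hx⟩)
  refine false_of_forall_near_max (k := k) hn hL hK hK' hsubset husc hlsc (C := max C₁ C₂)
    (fun x hx => (hC₁ x hx).trans (le_max_left _ _))
    (fun x hx => (hC₂ x hx).trans (le_max_right _ _)) hs0 hs1 hx₀
    (τ := min δ ((u x₀ - w x₀) / 4)) (by
      have : 0 < u x₀ - w x₀ := by linarith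
      positivity) fun x hx y hy hxy hval => ?_
  obtain ⟨-, hb⟩ := hball x hx
  refine ⟨?_, hsuper y (hb ?_)⟩
  · by_cases hi : x ∈ interior K
    · exact hsub x hi
    · refine hub x ?_ ?_
      · rw [hK.isClosed.frontier_eq]
        exact ⟨hx, hi⟩
      · rw [uscEnv_eq husc hC₁ hx]
        -- Near-maximality makes `s * u x - w y` positive, and `w y ≥ 0`; hence `u` is positive
        -- where its boundary condition is needed.
        have h1 : 0 < s * u x := by
          linarith [min_le_right δ ((u x₀ - w x₀) / 4), hw0 y hy]
        exact pos_of_mul_pos_right h1 hs0.le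
  · rw [Metric.mem_ball, dist_comm, dist_eq_norm]
    exact hxy.trans_le (min_le_left _ _)

end MaximumPrinciple

end CodimFlow

end

theorem theorem4p2 (n k : ℕ) (hn : 2 ≤ n) (hk : 1 ≤ k) (hkn : k ≤ n - 1)
    (L : ℝ) (hL : 1 ≤ L)
    (K : Set (EuclideanSpace ℝ (Fin n))) (hK : IsCompact K)
    (u : EuclideanSpace ℝ (Fin n) → ℝ) (hu_usc : UpperSemicontinuousOn u K)
    (hu : IsViscositySubsolution k L K u) :
    (K.Nonempty →
      ∀ w : EuclideanSpace ℝ (Fin n) → ℝ, LowerSemicontinuousOn w K →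
        IsViscositySupersolution k L K w →
        ∃ x ∈ frontier K, IsMaxOn (fun y => u y - w y) K x) ∧
    (SubZeroBoundary k L K u →
      ∀ (K' : Set (EuclideanSpace ℝ (Fin n))) (w : EuclideanSpace ℝ (Fin n) → ℝ),
        IsCompact K' → K ⊆ interior K' → LowerSemicontinuousOn w K' →
        IsViscositySupersolution k L K' w → SuperZeroBoundary k L K' w →
        ∀ x ∈ K, u x ≤ w x) :=
  ⟨fun hne _ hlsc hw =>
      exists_isMaxOn_frontier (by linarith) (by linarith) hK hne hu_usc hu hlsc hw,
    fun hub _ _ hK' hKK' hlsc hw hwb =>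
      le_of_zeroBoundary (by linarith) (by linarith) hK hK' hKK' hu_usc hu hub hlsc hw hwb⟩
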